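/- **Setting.** Let $\mathbf{Loc}_m$ be the category of oriented and time-oriented globally hyperbolic Lorentzian manifolds of dimension $m$ (globally hyperbolic: there is a Cauchy surface, i.e. a subset met exactly once by every inextendible future directed timelike curve); its morphisms are the orientation and time-orientation preserving isometric embeddings with open and causally convex image. A tuple $\underline f=(f_1:M_1\to N,\dots,f_n:M_n\to N)$, $n\ge 0$, of morphisms is *time-ordered* if $J^+_N(f_i(M_i))\cap f_j(M_j)=\emptyset$ for all $i<j$, and *time-orderable* if $(f_{\rho(1)},\dots,f_{\rho(n)})$ is time-ordered for some permutation $\rho$. A *free BV theory* $(F,Q,(-,-),W)$ on $M\in\mathbf{Loc}_m$ consists of a $\mathbb Z$-graded real vector bundle $F=(F^n)_n$ on $M$, with each $F^n$ of finite rank; linear differential operators $Q:\Gamma(F^n)\to\Gamma(F^{n+1})$ with $Q^2=0$; fiberwise pairings $(-,-):F^p\otimes F^q\to\mathbb R$, zero unless $p+q=1$, which are smooth, fiberwise non-degenerate, graded anti-symmetric, $(a,b)=-(-1)^{pq}(b,a)$, and satisfy $\int_M (Q\varphi_1,\varphi_2)\,\mathrm{vol}_M+(-1)^{|\varphi_1|}\int_M(\varphi_1,Q\varphi_2)\,\mathrm{vol}_M=0$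 for all sections with compact overlapping support; and a Green's witness, i.e. linear differential operators $W:\Gamma(F^n)\to\Gamma(F^{n-1})$ such that $QW+WQ$ is Green hyperbolic in each degree (it has retarded and advanced Green's operators), $QWW=WWQ$, and $\int_M(W\varphi_1,\varphi_2)\,\mathrm{vol}_M=(-1)^{|\varphi_1|}\int_M(\varphi_1,W\varphi_2)\,\mathrm{vol}_M$ for sections with compact overlapping support. A *natural collection* $(F_M,Q_M,(-,-)_M,W_M)_{M\in\mathbf{Loc}_m}$ consists of a free BV theory on each $M$ and, for every morphism $f:M\to N$, functorially in $f$, a smooth fiberwise linear isomorphism $F_M\to F_N$ covering $f$ which preserves the pairings and intertwines the operators $Q$ and $W$ (along pullback of sections). **Quantum observables.** Fix a natural collection of free BV theories and $\hbar>0$. Let $\mathfrak F_{\mathrm c}(M)[1]$ have the compactly supported sections of $F_M^{n+1}$ in degree $n$ and the differential $-Q_M$, and let $$\tau_{(-1)}(\psi_1\otimes\psi_2)=(-1)^{|\psi_1|}\int_M(\psi_1,\psi_2)_M\,\mathrm{vol}_M ,$$ where $|\psi_1|$ is the degree in $\mathfrak F_{\mathrm c}(M)[1]$. On the graded symmetric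 algebra $\mathrm{Sym}(\mathfrak F_{\mathrm c}(M)[1])$ of the complexification, let $\mathcal Q$ be the graded derivation extending $-Q_M$, and let $\Delta_{\mathrm{BV}}$ be the Laplacian of $\tau_{(-1)}$: the linear map of degree $1$ with $\Delta_{\mathrm{BV}}(1)=0$ and $\Delta_{\mathrm{BV}}(v\,a)=(-1)^{|v|}v\,\Delta_{\mathrm{BV}}(a)+D_v(a)$ for homogeneous generators $v$ and all $a$, where $D_v$ is the graded derivation of degree $|v|+1$ with $D_v(w)=\tau_{(-1)}(v\otimes w)$ on generators $w$. Put $$\mathcal Q_\hbar=\mathcal Q+\mathrm i\hbar\,\Delta_{\mathrm{BV}},\qquad \mathcal F(M)=\big(\mathrm{Sym}(\mathfrak F_{\mathrm c}(M)[1]),\mathcal Q_\hbar\big).$$ For a time-orderable tuple $\underline f:\underline M\to N$ of length $n$, the *time-ordered product* is $$\mathcal F(\underline f)=\mu^{(n)}\circ\bigotimes_{i=1}^n f_{i*}:\ \mathcal F(\underline M):=\bigotimes_{i=1}^n\mathcal F(M_i)\longrightarrow\mathcal F(N),$$ where $f_{i*}$ is the algebra map extending the pushforward (extension by zero) of compactly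 supported sections and $\mu^{(n)}$ is the $n$-ary multiplication of the symmetric algebra ($\mu^{(0)}$ being the unit). **Proposition.** (1) For every time-orderable tuple $\underline f:\underline M\to N$, the time-ordered product $\mathcal F(\underline f)$ is a cochain map: it preserves degrees and $$\mathcal Q_\hbar\,\mathcal F(\underline f)=\mathcal F(\underline f)\,\mathcal Q_{\hbar\,\otimes},$$ where $\mathcal Q_{\hbar\,\otimes}$ is the differential of the tensor product $\mathcal F(\underline M)$ (with Koszul signs). (2) These data define a time-orderable prefactorization algebra on $\mathbf{Loc}_m$ with values in cochain complexes over $\mathbb C$, that is: * each $\mathcal F(M)$ is a cochain complex and each $\mathcal F(\underline f)$ is a cochain map; * if $\underline f:\underline M\to N$ and $\underline g_i:\underline L_i\to M_i$, $i=1,\dots,n$, are time-orderable, then so is the composite tuple $\underline f(\underline g_1,\dots,\underline g_n)=(f_1g_{11},\dots,f_ng_{nk_n})$, and $\mathcal F(\underline f)\circ\bigotimes_i\mathcal F(\underline g_i)=\mathcal F(\underline f(\underline g_1,\dots,\underline g_n))$; * $\mathcal F(\mathrm{id}_M)=\mathrm{id}_{\mathcal F(M)}$; * for every time-orderable $\underline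 f$ of length $n$ and every permutation $\sigma\in\Sigma_n$, the tuple $\underline f\sigma=(f_{\sigma(1)},\dots,f_{\sigma(n)})$ is time-orderable and $\mathcal F(\underline f\sigma)\circ\gamma_\sigma=\mathcal F(\underline f)$, where $\gamma_\sigma(x_1\otimes\dots\otimes x_n)=\pm\,x_{\sigma(1)}\otimes\dots\otimes x_{\sigma(n)}$ with the Koszul sign. -/

import Mathlib

open scoped Manifold ContDiff Bundle TensorProduct
open scoped DirectSum
open Filter Topology

universe u v

/-- `ℝ^m` -/
abbrev MSpace (m : ℕ) : Type := EuclideanSpace ℝ (Fin m)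

/-- An oriented and time-oriented Lorentzian manifold of dimension `m`. -/
structure LorentzManifold (m : ℕ) where
  carrier : Type u
  [topology : TopologicalSpace carrier]
  [charted : ChartedSpace (MSpace m) carrier]
  [smooth : IsManifold (𝓡 m) ∞ carrier]
  [t2 : T2Space carrier]
  [secondCountable : SecondCountableTopology carrier]
  g (x : carrier) : TangentSpace (𝓡 m) x →L[ℝ] TangentSpace (𝓡 m) x →L[ℝ] ℝ
  g_symm (x : carrier) (v w : TangentSpace (𝓡 m) x) : g x v w = g x w v
  g_smooth : ContMDiff (𝓡 m) ((𝓡 m).prod 𝓘(ℝ, MSpace m →L[ℝ] MSpace m →L[ℝ] ℝ)) ∞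
    (fun x : carrier ↦ (Bundle.TotalSpace.mk' (MSpace m →L[ℝ] MSpace m →L[ℝ] ℝ)
      (E := fun x : carrier ↦ TangentSpace (𝓡 m) x →L[ℝ] TangentSpace (𝓡 m) x →L[ℝ] ℝ) x (g x)))
  g_signature (x : carrier) : ∃ e : TangentSpace (𝓡 m) x, g x e e < 0 ∧
    ∀ w : TangentSpace (𝓡 m) x, g x e w = 0 → w ≠ 0 → 0 < g x w w
  orientation (x : carrier) : Orientation ℝ (TangentSpace (𝓡 m) x) (Fin m)
  orientation_continuous (x₀ : carrier) : ∀ᶠ x in 𝓝 x₀,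
    ∀ (hx : x ∈ (trivializationAt (MSpace m) (TangentSpace (𝓡 m)) x₀).baseSet)
      (hx₀ : x₀ ∈ (trivializationAt (MSpace m) (TangentSpace (𝓡 m)) x₀).baseSet),
      Orientation.map (Fin m) ((trivializationAt (MSpace m) (TangentSpace (𝓡 m)) x₀).linearEquivAt
        ℝ x hx) (orientation x) =
      Orientation.map (Fin m) ((trivializationAt (MSpace m) (TangentSpace (𝓡 m)) x₀).linearEquivAt
        ℝ x₀ hx₀) (orientation x₀)
  t (x : carrier) : TangentSpace (𝓡 m) x
  t_smooth : ContMDiff (𝓡 m) (𝓡 m).tangent ∞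
    (fun x : carrier ↦ (⟨x, t x⟩ : TangentBundle (𝓡 m) carrier))
  t_timelike (x : carrier) : g x (t x) (t x) < 0

namespace LorentzManifold
variable {m : ℕ}
instance : CoeSort (LorentzManifold.{u} m) (Type u) := ⟨carrier⟩
attribute [instance] topology charted smooth t2 secondCountable
end LorentzManifold

namespace LorentzManifold
variable {m : ℕ} (M : LorentzManifold.{u} m)

/-- The tangent vector `ċ(s)` of a curve `c` in `M`. -/
noncomputable def velocity (c : ℝ → M) (s : ℝ) : TangentSpace (𝓡 m) (c s) :=
  mfderiv 𝓘(ℝ, ℝ) (𝓡 m) c s (1 : ℝ)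

/-- `c` restricted to `I` is a smooth curve defined on a (non-empty) open interval. -/
structure IsCurve (I : Set ℝ) (c : ℝ → M) : Prop where
  isOpen : IsOpen I
  ordConnected : I.OrdConnected
  nonempty : I.Nonempty
  smooth : ContMDiffOn 𝓘(ℝ, ℝ) (𝓡 m) ∞ c I

/-- Future directed causal curves `c : I → M` (the second inequality forces `ċ ≠ 0`). -/
structure IsFutureCausalCurve (I : Set ℝ) (c : ℝ → M) : Prop extends M.IsCurve I c where
  causal : ∀ s ∈ I, M.g (c s) (M.velocity c s) (M.velocity c s) ≤ 0
  future : ∀ s ∈ I, M.g (c s) (M.t (c s)) (M.velocity c s) < 0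

/-- Past directed causal curves `c : I → M`. -/
structure IsPastCausalCurve (I : Set ℝ) (c : ℝ → M) : Prop extends M.IsCurve I c where
  causal : ∀ s ∈ I, M.g (c s) (M.velocity c s) (M.velocity c s) ≤ 0
  past : ∀ s ∈ I, 0 < M.g (c s) (M.t (c s)) (M.velocity c s)

/-- Future directed timelike curves `c : I → M`. -/
structure IsFutureTimelikeCurve (I : Set ℝ) (c : ℝ → M) : Prop extends M.IsCurve I c where
  timelike : ∀ s ∈ I, M.g (c s) (M.velocity c s) (M.velocity c s) < 0
  future : ∀ s ∈ I, M.g (c s) (M.t (c s)) (M.velocity c s) < 0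

/-- The causal future `J⁺(S)`. -/
def causalFuture (S : Set M) : Set M :=
  S ∪ {y | ∃ (I : Set ℝ) (c : ℝ → M), M.IsFutureCausalCurve I c ∧
    ∃ a ∈ I, ∃ b ∈ I, a < b ∧ c a ∈ S ∧ c b = y}

/-- The causal past `J⁻(S)`. -/
def causalPast (S : Set M) : Set M :=
  S ∪ {y | ∃ (I : Set ℝ) (c : ℝ → M), M.IsPastCausalCurve I c ∧
    ∃ a ∈ I, ∃ b ∈ I, a < b ∧ c a ∈ S ∧ c b = y}

/-- Causally convex subsets. -/
def CausallyConvex (S : Set M) : Prop := M.causalFuture S ∩ M.causalPast S ⊆ S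

/-- A curve `c : I → M` is inextendible if it has neither a future nor a past endpoint in `M`. -/
def Inextendible (I : Set ℝ) (c : ℝ → M) : Prop :=
  (¬ ∃ p, Tendsto (fun s : I ↦ c s) atTop (𝓝 p)) ∧ ¬ ∃ p, Tendsto (fun s : I ↦ c s) atBot (𝓝 p)

/-- A Cauchy surface is a subset met exactly once by each inextendible future directed
timelike curve. -/
def IsCauchySurface (S : Set M) : Prop :=
  ∀ (I : Set ℝ) (c : ℝ → M), M.IsFutureTimelikeCurve I c → M.Inextendible I c →
    ∃! s, s ∈ I ∧ c s ∈ S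

end LorentzManifold

/-- Objects of the category `Loc_m`: oriented and time-oriented globally hyperbolic Lorentzian
manifolds of dimension `m`. -/
structure Loc (m : ℕ) extends LorentzManifold.{u} m where
  globallyHyperbolic : ∃ S : Set carrier, toLorentzManifold.IsCauchySurface S

/-- Morphisms `M ⟶ N` of `Loc_m`: orientation and time-orientation preserving isometric
embeddings with open and causally convex image. (An embedding with open image between manifolds
of equal dimension is an injective local diffeomorphism.) -/
structure LorentzEmbedding {m : ℕ} (M N : LorentzManifold.{u} m) where
  toFun : M → N
  injective : Function.Injective toFun
  localDiffeo : IsLocalDiffeomorph (𝓡 m) (𝓡 m) ∞ toFun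
  isometric (x : M) (v w : TangentSpace (𝓡 m) x) :
    N.g (toFun x) (mfderiv (𝓡 m) (𝓡 m) toFun x v) (mfderiv (𝓡 m) (𝓡 m) toFun x w) = M.g x v w
  /-- a causal tangent vector is future directed if and only if its image is -/
  timeOrientation (x : M) (v : TangentSpace (𝓡 m) x) : M.g x v v ≤ 0 →
    (N.g (toFun x) (N.t (toFun x)) (mfderiv (𝓡 m) (𝓡 m) toFun x v) < 0 ↔ M.g x (M.t x) v < 0)
  orientation (x : M) : ∃ e : TangentSpace (𝓡 m) x ≃ₗ[ℝ] TangentSpace (𝓡 m) (toFun x),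
    (∀ v, e v = mfderiv (𝓡 m) (𝓡 m) toFun x v) ∧
      Orientation.map (Fin m) e (M.orientation x) = N.orientation (toFun x)
  causallyConvex : N.CausallyConvex (Set.range toFun)

namespace LorentzEmbedding
variable {m : ℕ} {M N L : LorentzManifold.{u} m}

instance : CoeFun (LorentzEmbedding M N) (fun _ ↦ M → N) := ⟨toFun⟩

@[ext] theorem ext {f h : LorentzEmbedding M N} (H : f.toFun = h.toFun) : f = h := by
  cases f; cases h; cases H; rfl

theorem mdifferentiableAt (f : LorentzEmbedding M N) (x : M) :
    MDifferentiableAt (𝓡 m) (𝓡 m) f.toFun x :=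
  f.localDiffeo.mdifferentiable (by simp) x

/-- The identity morphism. -/
def id (M : LorentzManifold.{u} m) : LorentzEmbedding M M where
  toFun x := x
  injective := Function.injective_id
  localDiffeo := (Diffeomorph.refl (𝓡 m) M ∞).isLocalDiffeomorph
  isometric x v w := by
    have : mfderiv (𝓡 m) (𝓡 m) (fun x : M ↦ x) x = ContinuousLinearMap.id ℝ _ := mfderiv_id
    rw [this]; rfl
  timeOrientation x v _ := by
    have : mfderiv (𝓡 m) (𝓡 m) (fun x : M ↦ x) x = ContinuousLinearMap.id ℝ _ := mfderiv_id
    rw [this]; rfl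
  orientation x := ⟨LinearEquiv.refl ℝ _, fun v ↦ by
    have : mfderiv (𝓡 m) (𝓡 m) (fun x : M ↦ x) x = ContinuousLinearMap.id ℝ _ := mfderiv_id
    rw [this]; rfl, by simp⟩
  causallyConvex := fun x _ ↦ ⟨x, rfl⟩

theorem mfderiv_comp_apply (h : LorentzEmbedding N L) (f : LorentzEmbedding M N) (x : M)
    (v : TangentSpace (𝓡 m) x) :
    mfderiv (𝓡 m) (𝓡 m) (fun y ↦ h.toFun (f.toFun y)) x v =
      mfderiv (𝓡 m) (𝓡 m) h.toFun (f.toFun x) (mfderiv (𝓡 m) (𝓡 m) f.toFun x v) := by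
  have := mfderiv_comp x (h.mdifferentiableAt (f.toFun x)) (f.mdifferentiableAt x)
  exact congrArg (fun T ↦ T v) this

/-- A smooth curve in the image of a morphism lifts to a smooth curve. -/
theorem lift_curve (h : LorentzEmbedding N L) {I : Set ℝ} {c : ℝ → L} (hc : L.IsCurve I c)
    {a b : ℝ} (ha : a ∈ I) (hb : b ∈ I) (hab : a < b)
    (hr : ∀ s ∈ Set.Icc a b, c s ∈ Set.range h.toFun) :
    ∃ (I' : Set ℝ) (c' : ℝ → N), N.IsCurve I' c' ∧ a ∈ I' ∧ b ∈ I' ∧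
      ∀ s ∈ I', s ∈ I ∧ h.toFun (c' s) = c s ∧
        N.g (c' s) (N.velocity c' s) (N.velocity c' s) =
          L.g (c s) (L.velocity c s) (L.velocity c s) ∧
        (L.g (c s) (L.velocity c s) (L.velocity c s) ≤ 0 →
          (L.g (c s) (L.t (c s)) (L.velocity c s) < 0 ↔
            N.g (c' s) (N.t (c' s)) (N.velocity c' s) < 0) ∧
          (0 < L.g (c s) (L.t (c s)) (L.velocity c s) ↔
            0 < N.g (c' s) (N.t (c' s)) (N.velocity c' s))) := by
  have hcont : ContinuousOn c I := hc.smooth.continuousOn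
  have hU : IsOpen (I ∩ c ⁻¹' Set.range h.toFun) :=
    hcont.isOpen_inter_preimage hc.isOpen h.localDiffeo.isOpen_range
  set U := I ∩ c ⁻¹' Set.range h.toFun with hUdef
  have hIcc : Set.Icc a b ⊆ U := fun s hs ↦ ⟨hc.ordConnected.out ha hb hs, hr s hs⟩
  obtain ⟨δ, hδ, hδU⟩ := Metric.isOpen_iff.1 hU a (hIcc ⟨le_rfl, hab.le⟩)
  obtain ⟨η, hη, hηU⟩ := Metric.isOpen_iff.1 hU b (hIcc ⟨hab.le, le_rfl⟩)
  have hI' : Set.Ioo (a - δ) (b + η) ⊆ U := by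
    intro s hs
    rcases lt_or_ge s a with h1 | h1
    · apply hδU
      rw [Metric.mem_ball, Real.dist_eq, abs_lt]
      constructor <;> linarith [hs.1]
    rcases le_or_gt s b with h2 | h2
    · exact hIcc ⟨h1, h2⟩
    · apply hηU
      rw [Metric.mem_ball, Real.dist_eq, abs_lt]
      constructor <;> linarith [hs.2]
  obtain ⟨n₀, -⟩ := (hIcc ⟨le_rfl, hab.le⟩).2
  have : Nonempty N := ⟨n₀⟩
  let c' : ℝ → N := fun s ↦ Function.invFun h.toFun (c s)
  have hc' : ∀ s ∈ U, h.toFun (c' s) = c s := fun s hs ↦ Function.invFun_eq hs.2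
  have hsm : ∀ s ∈ U, ContMDiffAt 𝓘(ℝ, ℝ) (𝓡 m) ∞ c' s := by
    intro s hs
    have hd := h.localDiffeo (c' s)
    have h1 : ContMDiffAt (𝓡 m) (𝓡 m) ∞ hd.localInverse (c s) := by
      rw [← hc' s hs]; exact hd.localInverse_contMDiffAt
    have h2 : ContMDiffAt 𝓘(ℝ, ℝ) (𝓡 m) ∞ c s := hc.smooth.contMDiffAt (hc.isOpen.mem_nhds hs.1)
    have h3 : ∀ᶠ u in 𝓝 s, c' u = hd.localInverse (c u) := by
      have h4 := hd.localInverse_eventuallyEq_right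
      rw [hc' s hs] at h4
      filter_upwards [h2.continuousAt.eventually h4, hU.mem_nhds hs] with u hu huU
      apply h.injective
      rw [hc' u huU]
      exact hu.symm
    exact (h1.comp s h2).congr_of_eventuallyEq h3
  refine ⟨Set.Ioo (a - δ) (b + η), c',
    ⟨isOpen_Ioo, Set.ordConnected_Ioo, ⟨a, by constructor <;> linarith⟩,
      fun s hs ↦ (hsm s (hI' hs)).contMDiffWithinAt⟩, by constructor <;> linarith,
      by constructor <;> linarith, fun s hs ↦ ?_⟩
  have hsU := hI' hs
  have hev : c =ᶠ[𝓝 s] fun u ↦ h.toFun (c' u) := by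
    filter_upwards [hU.mem_nhds hsU] with u hu using (hc' u hu).symm
  have hvel : (L.velocity c s : MSpace m) =
      mfderiv (𝓡 m) (𝓡 m) h.toFun (c' s) (N.velocity c' s) := by
    have e1 := hev.mfderiv_eq (I := 𝓘(ℝ, ℝ)) (I' := 𝓡 m)
    have e2 := mfderiv_comp s (h.mdifferentiableAt (c' s))
      ((hsm s hsU).mdifferentiableAt (by simp))
    have e3 := congrArg (fun T : ℝ →L[ℝ] MSpace m ↦ T 1) (e1.trans e2)
    exact e3
  have key1 : ∀ (p : L) (v : MSpace m), p = h.toFun (c' s) →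
      v = mfderiv (𝓡 m) (𝓡 m) h.toFun (c' s) (N.velocity c' s) →
      N.g (c' s) (N.velocity c' s) (N.velocity c' s) =
          L.g p v v ∧
        (L.g p v v ≤ 0 →
          (L.g p (L.t p) v < 0 ↔ N.g (c' s) (N.t (c' s)) (N.velocity c' s) < 0) ∧
          (0 < L.g p (L.t p) v ↔ 0 < N.g (c' s) (N.t (c' s)) (N.velocity c' s))) := by
    rintro p v rfl rfl
    have hiso := h.isometric (c' s) (N.velocity c' s) (N.velocity c' s)
    refine ⟨hiso.symm, fun hle ↦ ⟨h.timeOrientation _ _ (hiso ▸ hle), ?_⟩⟩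
    have := h.timeOrientation (c' s) (-N.velocity c' s) (by simpa using hiso ▸ hle)
    simpa using this
  exact ⟨hsU.1, hc' s hsU, key1 (c s) (L.velocity c s) (hc' s hsU).symm hvel⟩

theorem reverse_curve {I : Set ℝ} {c : ℝ → L} (hc : L.IsCurve I c) :
    L.IsCurve (Neg.neg ⁻¹' I) (fun s ↦ c (-s)) ∧
      ∀ s, -s ∈ I → (L.velocity (fun s ↦ c (-s)) s : MSpace m) = -L.velocity c (-s) := by
  have hneg : ContMDiff 𝓘(ℝ, ℝ) 𝓘(ℝ, ℝ) ∞ (fun s : ℝ ↦ -s) := contDiff_neg.contMDiff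
  refine ⟨⟨hc.isOpen.preimage continuous_neg, ?_, ?_, ?_⟩, fun s hs ↦ ?_⟩
  · refine ⟨fun x hx y hy z hz ↦ hc.ordConnected.out hy hx ⟨neg_le_neg hz.2, neg_le_neg hz.1⟩⟩
  · obtain ⟨x, hx⟩ := hc.nonempty
    exact ⟨-x, by simpa using hx⟩
  · exact hc.smooth.comp hneg.contMDiffOn (fun s hs ↦ hs)
  · have h1 : MDifferentiableAt 𝓘(ℝ, ℝ) (𝓡 m) c (-s) :=
      (hc.smooth.contMDiffAt (hc.isOpen.mem_nhds hs)).mdifferentiableAt (by simp)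
    have h2 := mfderiv_comp s h1 ((hneg s).mdifferentiableAt (by simp))
    have h3 : mfderiv 𝓘(ℝ, ℝ) 𝓘(ℝ, ℝ) (fun s : ℝ ↦ -s) s (1 : ℝ) = (-1 : ℝ) := by
      rw [mfderiv_eq_fderiv]
      change (fderiv ℝ (fun s : ℝ ↦ -s) s : ℝ →L[ℝ] ℝ) 1 = -1
      simp
    have h4 : (L.velocity (fun s ↦ c (-s)) s : MSpace m) =
        mfderiv 𝓘(ℝ, ℝ) (𝓡 m) c (-s)
          (mfderiv 𝓘(ℝ, ℝ) 𝓘(ℝ, ℝ) (fun s : ℝ ↦ -s) s (1 : ℝ)) :=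
      congrArg (fun T : ℝ →L[ℝ] MSpace m ↦ T 1) h2
    rw [h4, h3]
    exact map_neg (mfderiv 𝓘(ℝ, ℝ) (𝓡 m) c (-s)) (1 : ℝ)

theorem reverse_future {I : Set ℝ} {c : ℝ → L} (hc : L.IsFutureCausalCurve I c) :
    L.IsPastCausalCurve (Neg.neg ⁻¹' I) (fun s ↦ c (-s)) := by
  obtain ⟨h1, h2⟩ := reverse_curve hc.toIsCurve
  refine ⟨h1, fun s hs ↦ ?_, fun s hs ↦ ?_⟩
  · have h := hc.causal (-s) hs
    have h3 : L.velocity (fun s ↦ c (-s)) s = -L.velocity c (-s) := h2 s hs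
    rw [h3]
    simpa using h
  · have h := hc.future (-s) hs
    have h3 : L.velocity (fun s ↦ c (-s)) s = -L.velocity c (-s) := h2 s hs
    rw [h3]
    simpa using h

theorem reverse_past {I : Set ℝ} {c : ℝ → L} (hc : L.IsPastCausalCurve I c) :
    L.IsFutureCausalCurve (Neg.neg ⁻¹' I) (fun s ↦ c (-s)) := by
  obtain ⟨h1, h2⟩ := reverse_curve hc.toIsCurve
  refine ⟨h1, fun s hs ↦ ?_, fun s hs ↦ ?_⟩
  · have h := hc.causal (-s) hs
    have h3 : L.velocity (fun s ↦ c (-s)) s = -L.velocity c (-s) := h2 s hs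
    rw [h3]
    simpa using h
  · have h := hc.past (-s) hs
    have h3 : L.velocity (fun s ↦ c (-s)) s = -L.velocity c (-s) := h2 s hs
    rw [h3]
    simpa using h

/-- If the endpoints of a causal curve lie in a causally convex subset, so does the curve. -/
theorem mem_of_future {S : Set L} (hS : L.CausallyConvex S) {I : Set ℝ} {c : ℝ → L}
    (hc : L.IsFutureCausalCurve I c) {a b : ℝ} (ha : a ∈ I) (hb : b ∈ I)
    (haS : c a ∈ S) (hbS : c b ∈ S) : ∀ s ∈ Set.Icc a b, c s ∈ S := by
  intro s hs
  have hsI : s ∈ I := hc.ordConnected.out ha hb hs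
  refine hS ⟨?_, ?_⟩
  · rcases hs.1.eq_or_lt with rfl | h
    · exact Or.inl haS
    · exact Or.inr ⟨I, c, hc, a, ha, s, hsI, h, haS, rfl⟩
  · rcases hs.2.eq_or_lt with rfl | h
    · exact Or.inl hbS
    · refine Or.inr ⟨_, _, reverse_future hc, -b, ?_, -s, ?_, neg_lt_neg h, ?_, ?_⟩ <;> simp [*]

theorem mem_of_past {S : Set L} (hS : L.CausallyConvex S) {I : Set ℝ} {c : ℝ → L}
    (hc : L.IsPastCausalCurve I c) {a b : ℝ} (ha : a ∈ I) (hb : b ∈ I)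
    (haS : c a ∈ S) (hbS : c b ∈ S) : ∀ s ∈ Set.Icc a b, c s ∈ S := by
  intro s hs
  have := mem_of_future hS (reverse_past hc) (a := -b) (b := -a) (by simpa) (by simpa)
    (by simpa) (by simpa) (-s) ⟨neg_le_neg hs.2, neg_le_neg hs.1⟩
  simpa using this

theorem mem_causalFuture_of_image (h : LorentzEmbedding N L) {S : Set N} {y : N}
    (hy : h.toFun y ∈ L.causalFuture (h.toFun '' S)) : y ∈ N.causalFuture S := by
  rcases hy with ⟨z, hz, hzy⟩ | ⟨I, c, hc, a, ha, b, hb, hab, ⟨z, hz, hza⟩, hcb⟩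
  · exact Or.inl (h.injective hzy ▸ hz)
  · obtain ⟨I', c', hI', ha', hb', H⟩ := h.lift_curve hc.toIsCurve ha hb hab
      (mem_of_future h.causallyConvex hc ha hb ⟨z, hza⟩ ⟨y, hcb.symm⟩)
    refine Or.inr ⟨I', c', ⟨hI', fun s hs ↦ ?_, fun s hs ↦ ?_⟩, a, ha', b, hb', hab, ?_, ?_⟩
    · rw [(H s hs).2.2.1]; exact hc.causal s (H s hs).1
    · exact ((H s hs).2.2.2 (hc.causal s (H s hs).1)).1.1 (hc.future s (H s hs).1)
    · have : c' a = z := h.injective ((H a ha').2.1.trans hza.symm)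
      exact this ▸ hz
    · exact h.injective ((H b hb').2.1.trans hcb)

theorem mem_causalPast_of_image (h : LorentzEmbedding N L) {S : Set N} {y : N}
    (hy : h.toFun y ∈ L.causalPast (h.toFun '' S)) : y ∈ N.causalPast S := by
  rcases hy with ⟨z, hz, hzy⟩ | ⟨I, c, hc, a, ha, b, hb, hab, ⟨z, hz, hza⟩, hcb⟩
  · exact Or.inl (h.injective hzy ▸ hz)
  · obtain ⟨I', c', hI', ha', hb', H⟩ := h.lift_curve hc.toIsCurve ha hb hab
      (mem_of_past h.causallyConvex hc ha hb ⟨z, hza⟩ ⟨y, hcb.symm⟩)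
    refine Or.inr ⟨I', c', ⟨hI', fun s hs ↦ ?_, fun s hs ↦ ?_⟩, a, ha', b, hb', hab, ?_, ?_⟩
    · rw [(H s hs).2.2.1]; exact hc.causal s (H s hs).1
    · exact ((H s hs).2.2.2 (hc.causal s (H s hs).1)).2.1 (hc.past s (H s hs).1)
    · have : c' a = z := h.injective ((H a ha').2.1.trans hza.symm)
      exact this ▸ hz
    · exact h.injective ((H b hb').2.1.trans hcb)

/-- Composition of morphisms. -/
def comp (h : LorentzEmbedding N L) (f : LorentzEmbedding M N) : LorentzEmbedding M L where
  toFun x := h.toFun (f.toFun x)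
  injective := h.injective.comp f.injective
  localDiffeo := fun x ↦ (f.localDiffeo x).comp _ _ (h.localDiffeo (f.toFun x))
  isometric x v w := by
    rw [mfderiv_comp_apply, mfderiv_comp_apply, h.isometric, f.isometric]
  timeOrientation x v hv := by
    rw [mfderiv_comp_apply, h.timeOrientation _ _ (by rwa [f.isometric]), f.timeOrientation x v hv]
  orientation x := by
    obtain ⟨e, he, he'⟩ := f.orientation x
    obtain ⟨e₂, he₂, he₂'⟩ := h.orientation (f.toFun x)
    refine ⟨e.trans e₂, fun v ↦ ?_, ?_⟩
    · rw [mfderiv_comp_apply, ← he v, ← he₂]; rfl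
    · rw [← he₂', ← he']
      induction M.orientation x using Module.Ray.ind with
      | h v hv => rfl
  causallyConvex := by
    have hR : Set.range (fun x ↦ h.toFun (f.toFun x)) = h.toFun '' Set.range f.toFun :=
      Set.range_comp h.toFun f.toFun
    rintro z ⟨hz1, hz2⟩
    have hsub : h.toFun '' Set.range f.toFun ⊆ Set.range h.toFun := Set.image_subset_range _ _
    rw [hR] at hz1 hz2 ⊢
    have hz : z ∈ Set.range h.toFun := by
      refine h.causallyConvex ⟨?_, ?_⟩
      · rcases hz1 with hz | ⟨I, c, hc, a, ha, b, hb, hab, hca, hcb⟩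
        exacts [Or.inl (hsub hz), Or.inr ⟨I, c, hc, a, ha, b, hb, hab, hsub hca, hcb⟩]
      · rcases hz2 with hz | ⟨I, c, hc, a, ha, b, hb, hab, hca, hcb⟩
        exacts [Or.inl (hsub hz), Or.inr ⟨I, c, hc, a, ha, b, hb, hab, hsub hca, hcb⟩]
    obtain ⟨y, rfl⟩ := hz
    exact ⟨y, f.causallyConvex
      ⟨h.mem_causalFuture_of_image hz1, h.mem_causalPast_of_image hz2⟩, rfl⟩

end LorentzEmbedding

instance Loc.category (m : ℕ) : CategoryTheory.Category (Loc.{u} m) where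
  Hom M N := LorentzEmbedding M.toLorentzManifold N.toLorentzManifold
  id M := LorentzEmbedding.id M.toLorentzManifold
  comp f h := h.comp f

/-! ### Vector bundles, sections and differential operators -/

/-- A smooth real vector bundle of finite rank over `M`. -/
structure SmoothVectorBundle {m : ℕ} (M : LorentzManifold.{u} m) where
  rank : ℕ
  Fiber : M → Type v
  [addCommGroup : ∀ x, AddCommGroup (Fiber x)]
  [module : ∀ x, Module ℝ (Fiber x)]
  [fiberTopology : ∀ x, TopologicalSpace (Fiber x)]
  [totalTopology : TopologicalSpace (Bundle.TotalSpace (MSpace rank) Fiber)]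
  [fiberBundle : FiberBundle (MSpace rank) Fiber]
  [vectorBundle : VectorBundle ℝ (MSpace rank) Fiber]
  [smoothBundle : ContMDiffVectorBundle ∞ (MSpace rank) Fiber (𝓡 m)]

namespace SmoothVectorBundle
variable {m : ℕ} {M : LorentzManifold.{u} m}

attribute [instance] addCommGroup module fiberTopology totalTopology fiberBundle vectorBundle
  smoothBundle

/-- The vector space `Γ(E)` of smooth sections. -/
abbrev Sections (E : SmoothVectorBundle.{u, v} M) : Type (max u v) :=
  ContMDiffSection (𝓡 m) (MSpace E.rank) ∞ E.Fiber

/-- The support of a section. -/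
def supp (E : SmoothVectorBundle.{u, v} M) (s : E.Sections) : Set M := closure {x | s x ≠ 0}

/-- The vector space `Γ_c(E)` of smooth sections with compact support. -/
def compactSections (E : SmoothVectorBundle.{u, v} M) : Submodule ℝ E.Sections where
  carrier := {s | IsCompact (E.supp s)}
  zero_mem' := by simp [supp]
  add_mem' {s t} hs ht := by
    refine (hs.union ht).of_isClosed_subset isClosed_closure ?_
    rw [supp, supp, supp, ← closure_union]
    refine closure_mono fun x hx ↦ ?_
    by_contra h
    simp only [Set.mem_union, Set.mem_ofPred_eq, not_or, not_not] at h
    exact hx (by simp [h.1, h.2])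
  smul_mem' c s hs := by
    refine hs.of_isClosed_subset isClosed_closure (closure_mono fun x hx h ↦ hx ?_)
    simp [h]

/-- Multiplication of sections by a smooth function. -/
noncomputable def mulFunction (E : SmoothVectorBundle.{u, v} M) (f : C^∞⟮𝓡 m, M; 𝓘(ℝ, ℝ), ℝ⟯) :
    E.Sections →ₗ[ℝ] E.Sections where
  toFun s := ⟨fun x ↦ f x • s x, f.contMDiff.smul_section s.contMDiff⟩
  map_add' s t := by ext x; exact smul_add _ _ _
  map_smul' c s := by ext x; exact smul_comm _ _ _

/-- Linear differential operators of order `< k` (Grothendieck's inductive definition): the only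
operator of order `< 0` is zero, and `P` has order `< k + 1` if the commutators `[P, f]` with all
smooth functions `f` have order `< k`. -/
def IsDiffOpOfOrderLT {E E' : SmoothVectorBundle.{u, v} M} :
    ℕ → (E.Sections →ₗ[ℝ] E'.Sections) → Prop
  | 0, P => P = 0
  | k + 1, P => ∀ f : C^∞⟮𝓡 m, M; 𝓘(ℝ, ℝ), ℝ⟯,
      IsDiffOpOfOrderLT k (P ∘ₗ E.mulFunction f - E'.mulFunction f ∘ₗ P)

/-- Linear differential operators (of some finite order). -/
def IsLinearDiffOp {E E' : SmoothVectorBundle.{u, v} M} (P : E.Sections →ₗ[ℝ] E'.Sections) :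
    Prop := ∃ k, IsDiffOpOfOrderLT k P

/-- Green hyperbolic operators: linear differential operators that admit a retarded Green's
operator `G₊` and an advanced Green's operator `G₋`. -/
def IsGreenHyperbolic {E : SmoothVectorBundle.{u, v} M} (P : E.Sections →ₗ[ℝ] E.Sections) :
    Prop :=
  IsLinearDiffOp P ∧ ∃ Gp Gm : E.compactSections →ₗ[ℝ] E.Sections,
    (∀ φ, P (Gp φ) = φ ∧ P (Gm φ) = φ) ∧
    (∀ φ Pφ : E.compactSections, (Pφ : E.Sections) = P φ → Gp Pφ = φ ∧ Gm Pφ = φ) ∧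
    (∀ φ, E.supp (Gp φ) ⊆ M.causalFuture (E.supp φ) ∧ E.supp (Gm φ) ⊆ M.causalPast (E.supp φ))

end SmoothVectorBundle

/-! ### Integration -/

namespace LorentzManifold
variable {m : ℕ} (M : LorentzManifold.{u} m)

instance sigmaCompact : SigmaCompactSpace M := by
  have : LocallyCompactSpace M := ChartedSpace.locallyCompactSpace (MSpace m) M
  infer_instance

/-- The coordinate vector field `∂ᵢ` of the chart around `p`, as a vector field on `M`
(zero outside of the domain of the chart). -/
noncomputable def coordField (p : M) (i : Fin m) (x : M) : TangentSpace (𝓡 m) x :=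
  (trivializationAt (MSpace m) (TangentSpace (𝓡 m)) p).localFrame
    (EuclideanSpace.basisFun (Fin m) ℝ).toBasis i x

/-- The density `√|det g(∂ᵢ, ∂ⱼ)|` of the volume form in the chart around `p`. -/
noncomputable def density (p : M) (x : M) : ℝ :=
  √|(Matrix.of fun i j ↦ M.g x (M.coordField p i x) (M.coordField p j x)).det|

/-- A smooth partition of unity subordinate to the chart domains. -/
noncomputable def partition : SmoothPartitionOfUnity M (𝓡 m) M Set.univ :=
  (SmoothPartitionOfUnity.exists_isSubordinate_chartAt_source (𝓡 m) (M : Type u)).choose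

theorem partition_subordinate :
    M.partition.IsSubordinate fun p ↦ (chartAt (MSpace m) p).source :=
  (SmoothPartitionOfUnity.exists_isSubordinate_chartAt_source (𝓡 m) (M : Type u)).choose_spec

/-- The contribution of the `p`-th chart to `∫_M h vol_M`. -/
noncomputable def chartIntegral (h : M → ℝ) (p : M) : ℝ :=
  ∫ y in (chartAt (MSpace m) p).target,
    M.partition p ((chartAt (MSpace m) p).symm y) * h ((chartAt (MSpace m) p).symm y) *
      M.density p ((chartAt (MSpace m) p).symm y)

/-- The integral `∫_M h vol_M` of a compactly supported continuous function `h`. -/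
noncomputable def integral (h : M → ℝ) : ℝ := ∑ᶠ p : M, M.chartIntegral h p

theorem continuousOn_density (p : M) :
    ContinuousOn (M.density p) (chartAt (MSpace m) p).source := by
  have h1 : ∀ i, ContMDiffOn (𝓡 m) (𝓡 m).tangent ∞
      (fun x ↦ (⟨x, M.coordField p i x⟩ : TangentBundle (𝓡 m) M))
      (chartAt (MSpace m) p).source := fun i ↦
    Bundle.Trivialization.contMDiffOn_localFrame_baseSet (n := ∞) (I := 𝓡 m)
      (trivializationAt (MSpace m) (TangentSpace (𝓡 m)) p) _ i
  have h2 : ∀ i j, ContinuousOn (fun x ↦ M.g x (M.coordField p i x) (M.coordField p j x))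
      (chartAt (MSpace m) p).source := by
    intro i j x hx
    have h3 : ContMDiffWithinAt (𝓡 m) ((𝓡 m).prod 𝓘(ℝ, ℝ)) ∞
        (fun x ↦ Bundle.TotalSpace.mk' ℝ (E := Bundle.Trivial M ℝ) x
          (M.g x (M.coordField p i x) (M.coordField p j x))) (chartAt (MSpace m) p).source x := by
      apply ContMDiffWithinAt.clm_bundle_apply₂ (F₁ := MSpace m) (F₂ := MSpace m)
      · exact M.g_smooth.contMDiffAt.contMDiffWithinAt
      · exact h1 i x hx
      · exact h1 j x hx
    simp only [Bundle.contMDiffWithinAt_totalSpace] at h3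
    exact h3.2.continuousWithinAt
  have h4 : ContinuousOn (fun x ↦ (Matrix.of fun i j ↦
      M.g x (M.coordField p i x) (M.coordField p j x)).det) (chartAt (MSpace m) p).source := by
    simp only [Matrix.det_apply, Matrix.of_apply]
    exact continuousOn_finsetSum _ fun σ _ ↦
      (continuousOn_finsetProd _ fun i _ ↦ h2 _ _).const_smul _
  exact h4.abs.sqrt

theorem chartIntegrand_integrable {h : M → ℝ} (hc : Continuous h) (hs : HasCompactSupport h)
    (p : M) : MeasureTheory.IntegrableOn (fun y ↦
      M.partition p ((chartAt (MSpace m) p).symm y) * h ((chartAt (MSpace m) p).symm y) *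
        M.density p ((chartAt (MSpace m) p).symm y)) (chartAt (MSpace m) p).target := by
  set φ := chartAt (MSpace m) p
  set K : Set M := tsupport (M.partition p) ∩ tsupport h with hK
  have hKc : IsCompact K := hs.inter_left (isClosed_tsupport _)
  have hKs : K ⊆ φ.source := fun x hx ↦ M.partition_subordinate p hx.1
  have hcont : ContinuousOn (fun y ↦ M.partition p (φ.symm y) * h (φ.symm y) *
      M.density p (φ.symm y)) φ.target := by
    refine ContinuousOn.mul (ContinuousOn.mul ?_ ?_) ?_
    · exact (M.partition p).contMDiff.continuous.comp_continuousOn φ.continuousOn_symm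
    · exact hc.comp_continuousOn φ.continuousOn_symm
    · exact (M.continuousOn_density p).comp φ.continuousOn_symm φ.mapsTo_symm
  have hcomp : IsCompact (φ '' K) := hKc.image_of_continuousOn (φ.continuousOn.mono hKs)
  have hsub : φ '' K ⊆ φ.target := by
    rintro _ ⟨x, hx, rfl⟩
    exact φ.map_source (hKs hx)
  have h1 : MeasureTheory.IntegrableOn (fun y ↦ M.partition p (φ.symm y) * h (φ.symm y) *
      M.density p (φ.symm y)) (φ '' K) := (hcont.mono hsub).integrableOn_compact hcomp
  refine h1.of_forall_sdiff_eq_zero φ.open_target.measurableSet fun y hy ↦ ?_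
  have hy' : φ.symm y ∉ K := fun hyK ↦ hy.2 ⟨_, hyK, φ.right_inv hy.1⟩
  rw [hK, Set.mem_inter_iff, not_and_or] at hy'
  rcases hy' with h | h
  · rw [image_eq_zero_of_notMem_tsupport h]; simp
  · rw [image_eq_zero_of_notMem_tsupport h]; simp

theorem chartIntegral_support_finite {h : M → ℝ} (hs : HasCompactSupport h) :
    (Function.support (M.chartIntegral h)).Finite := by
  have hfin := M.partition.locallyFinite.finite_nonempty_inter_compact hs
  refine hfin.subset fun p hp ↦ ?_
  by_contra hne
  refine hp (MeasureTheory.setIntegral_eq_zero_of_forall_eq_zero fun y _ ↦ ?_)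
  by_contra h0
  refine hne ⟨(chartAt (MSpace m) p).symm y, ?_, subset_tsupport _ ?_⟩ <;>
  · rw [Function.mem_support]
    intro h1
    simp [h1] at h0

theorem integral_add {h k : M → ℝ} (hc : Continuous h) (hs : HasCompactSupport h)
    (kc : Continuous k) (ks : HasCompactSupport k) :
    M.integral (fun x ↦ h x + k x) = M.integral h + M.integral k := by
  rw [integral, integral, integral, ← finsum_add_distrib (M.chartIntegral_support_finite hs)
    (M.chartIntegral_support_finite ks)]
  refine finsum_congr fun p ↦ ?_
  rw [chartIntegral, chartIntegral, chartIntegral, ← MeasureTheory.integral_add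
    (M.chartIntegrand_integrable hc hs p) (M.chartIntegrand_integrable kc ks p)]
  congr 1
  ext y
  ring

theorem integral_smul (c : ℝ) (h : M → ℝ) : M.integral (fun x ↦ c * h x) = c * M.integral h := by
  rw [integral, integral, ← smul_eq_mul, smul_finsum]
  refine finsum_congr fun p ↦ ?_
  rw [chartIntegral, chartIntegral, smul_eq_mul, ← MeasureTheory.integral_const_mul]
  congr 1
  ext y
  ring

end LorentzManifold

namespace SmoothVectorBundle
variable {m : ℕ} {M : LorentzManifold.{u} m}

theorem diffOp_apply_eq_zero {E E' : SmoothVectorBundle.{u, v} M} (k : ℕ) :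
    ∀ (P : E.Sections →ₗ[ℝ] E'.Sections), IsDiffOpOfOrderLT k P → ∀ (s : E.Sections) (x : M),
      x ∉ E.supp s → P s x = 0 := by
  induction k with
  | zero =>
    intro P hP s x _
    change P = 0 at hP
    rw [hP]; rfl
  | succ k ih =>
    intro P hP s x hx
    have hdisj : Disjoint ({x} : Set M) (E.supp s) := Set.disjoint_singleton_left.2 hx
    obtain ⟨f, hf0, hf1, -⟩ := exists_contMDiffMap_zero_one_of_isClosed (n := (⊤ : ℕ∞)) (𝓡 m)
      (isClosed_singleton (x := x)) (isClosed_closure (s := {x | s x ≠ 0})) hdisj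
    have hfs : E.mulFunction f s = s := by
      ext y
      change f y • s y = s y
      by_cases hy : s y = 0
      · rw [hy, smul_zero]
      · have h1 : f y = 1 := hf1 (subset_closure hy)
        rw [h1, one_smul]
    have h2 := ih _ (hP f) s x hx
    have h3 : P (E.mulFunction f s) x - f x • P s x = 0 := h2
    have h4 : f x = 0 := hf0 rfl
    rw [hfs, h4, zero_smul, sub_zero] at h3
    exact h3

/-- A linear differential operator restricts to compactly supported sections. -/
theorem mapsTo_compactSections {E E' : SmoothVectorBundle.{u, v} M}
    {P : E.Sections →ₗ[ℝ] E'.Sections} (hP : IsLinearDiffOp P) (s : E.Sections)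
    (hs : s ∈ E.compactSections) : P s ∈ E'.compactSections := by
  obtain ⟨k, hk⟩ := hP
  refine IsCompact.of_isClosed_subset (s := E.supp s) hs isClosed_closure ?_
  refine closure_minimal (fun x hx ↦ ?_) isClosed_closure
  by_contra h
  exact hx (diffOp_apply_eq_zero k P hk s x h)

end SmoothVectorBundle

/-! ### Free BV theories -/

section FreeBV
variable {m : ℕ}

/-- A complex of linear differential operators `(F, Q)` over `M`; the operator `Q p q` from degree
`p` to degree `q` is zero unless `q = p + 1`. -/
structure DiffOpComplex (M : LorentzManifold.{u} m) where
  F : ℤ → SmoothVectorBundle.{u, v} M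
  Q (p q : ℤ) : (F p).Sections →ₗ[ℝ] (F q).Sections
  Q_shape (p q : ℤ) : p + 1 ≠ q → Q p q = 0
  Q_diffOp (p q : ℤ) : SmoothVectorBundle.IsLinearDiffOp (Q p q)
  Q_comp_Q (p q r : ℤ) : Q q r ∘ₗ Q p q = 0

/-- A compatible `(-1)`-shifted fiber metric `(-,-) : F ⊗ F → M × ℝ[-1]`. As `ℝ[-1]` is
concentrated in degree `1`, the pairing of `F^p` with `F^q` is zero unless `p + q = 1`. -/
structure ShiftedFiberMetric {M : LorentzManifold.{u} m} (C : DiffOpComplex.{u, v} M) where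
  pair (p q : ℤ) (x : M) : (C.F p).Fiber x →ₗ[ℝ] (C.F q).Fiber x →ₗ[ℝ] ℝ
  degree (p q : ℤ) (x : M) : p + q ≠ 1 → pair p q x = 0
  smooth (p q : ℤ) (s : (C.F p).Sections) (t : (C.F q).Sections) :
    ContMDiff (𝓡 m) 𝓘(ℝ, ℝ) ∞ (fun x ↦ pair p q x (s x) (t x))
  antisymm (p q : ℤ) (x : M) (a : (C.F p).Fiber x) (b : (C.F q).Fiber x) :
    pair p q x a b = -((-1 : ℝ) ^ (p * q) * pair q p x b a)
  nondegenerate (p : ℤ) (x : M) (a : (C.F p).Fiber x) :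
    (∀ (q : ℤ) (b : (C.F q).Fiber x), pair p q x a b = 0) → a = 0
  compatible (p q : ℤ) (φ₁ : (C.F p).Sections) (φ₂ : (C.F q).Sections) :
    IsCompact ((C.F p).supp φ₁ ∩ (C.F q).supp φ₂) →
    M.integral (fun x ↦ pair (p + 1) q x (C.Q p (p + 1) φ₁ x) (φ₂ x)) +
      (-1 : ℝ) ^ p * M.integral (fun x ↦ pair p (q + 1) x (φ₁ x) (C.Q q (q + 1) φ₂ x)) = 0

/-- A (formally self-adjoint) Green's witness; the operator `W p q` from degree `p` to degree `q`
is zero unless `q = p - 1`. -/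
structure GreensWitness {M : LorentzManifold.{u} m} (C : DiffOpComplex.{u, v} M)
    (b : ShiftedFiberMetric C) where
  W (p q : ℤ) : (C.F p).Sections →ₗ[ℝ] (C.F q).Sections
  W_shape (p q : ℤ) : q + 1 ≠ p → W p q = 0
  W_diffOp (p q : ℤ) : SmoothVectorBundle.IsLinearDiffOp (W p q)
  greenHyperbolic (n : ℤ) : SmoothVectorBundle.IsGreenHyperbolic
    (C.Q (n - 1) n ∘ₗ W n (n - 1) + W (n + 1) n ∘ₗ C.Q n (n + 1))
  Q_W_W (n : ℤ) : C.Q (n - 2) (n - 1) ∘ₗ W (n - 1) (n - 2) ∘ₗ W n (n - 1) =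
    W n (n - 1) ∘ₗ W (n + 1) n ∘ₗ C.Q n (n + 1)
  selfAdjoint (p q : ℤ) (φ₁ : (C.F p).Sections) (φ₂ : (C.F q).Sections) :
    IsCompact ((C.F p).supp φ₁ ∩ (C.F q).supp φ₂) →
    M.integral (fun x ↦ b.pair (p - 1) q x (W p (p - 1) φ₁ x) (φ₂ x)) =
      (-1 : ℝ) ^ p * M.integral (fun x ↦ b.pair p (q - 1) x (φ₁ x) (W q (q - 1) φ₂ x))

/-- A free BV theory `(F, Q, (-,-), W)` on `M`. -/
structure FreeBVTheory (M : LorentzManifold.{u} m) extends DiffOpComplex.{u, v} M where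
  metric : ShiftedFiberMetric toDiffOpComplex
  witness : GreensWitness toDiffOpComplex metric

/-- The morphism of Lorentzian manifolds underlying a morphism of `Loc_m`. -/
abbrev Loc.emb {M N : Loc.{u} m} (f : M ⟶ N) :
    LorentzEmbedding M.toLorentzManifold N.toLorentzManifold := f

open CategoryTheory in
/-- A natural collection of free BV theories, indexed by the objects of `Loc_m`: every morphism
`f : M ⟶ N` is covered, functorially, by smooth fiberwise linear isomorphisms `F_M → F_N` which
preserve the fiber metrics and intertwine the operators `Q` and `W`, where sections `s` of `F_M`
and `t` of `F_N` correspond to each other (`s = f^* t`) if `f_*(s(x)) = t(f(x))` for all `x`. -/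
structure NaturalFreeBVTheory (m : ℕ) where
  theory (M : Loc.{u} m) : FreeBVTheory.{u, v} M.toLorentzManifold
  map {M N : Loc.{u} m} (f : M ⟶ N) (n : ℤ) (x : M.toLorentzManifold) :
    ((theory M).F n).Fiber x ≃ₗ[ℝ] ((theory N).F n).Fiber (Loc.emb f x)
  map_smooth {M N : Loc.{u} m} (f : M ⟶ N) (n : ℤ) :
    ContMDiff ((𝓡 m).prod 𝓘(ℝ, MSpace ((theory M).F n).rank))
      ((𝓡 m).prod 𝓘(ℝ, MSpace ((theory N).F n).rank)) ∞
      (fun z : Bundle.TotalSpace (MSpace ((theory M).F n).rank) ((theory M).F n).Fiber ↦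
        (⟨Loc.emb f z.1, map f n z.1 z.2⟩ :
          Bundle.TotalSpace (MSpace ((theory N).F n).rank) ((theory N).F n).Fiber))
  map_id (M : Loc.{u} m) (n : ℤ) (x : M.toLorentzManifold) (a : ((theory M).F n).Fiber x) :
    map (𝟙 M) n x a = a
  map_comp {L M N : Loc.{u} m} (f : L ⟶ M) (h : M ⟶ N) (n : ℤ) (x : L.toLorentzManifold)
    (a : ((theory L).F n).Fiber x) : map (f ≫ h) n x a = map h n (Loc.emb f x) (map f n x a)
  map_metric {M N : Loc.{u} m} (f : M ⟶ N) (p q : ℤ) (x : M.toLorentzManifold)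
    (a : ((theory M).F p).Fiber x) (b : ((theory M).F q).Fiber x) :
    (theory N).metric.pair p q (Loc.emb f x) (map f p x a) (map f q x b) =
      (theory M).metric.pair p q x a b
  map_Q {M N : Loc.{u} m} (f : M ⟶ N) (p q : ℤ) (s : ((theory M).F p).Sections)
    (t : ((theory N).F p).Sections) : (∀ x, map f p x (s x) = t (Loc.emb f x)) →
    ∀ x, map f q x ((theory M).Q p q s x) = (theory N).Q p q t (Loc.emb f x)
  map_W {M N : Loc.{u} m} (f : M ⟶ N) (p q : ℤ) (s : ((theory M).F p).Sections)
    (t : ((theory N).F p).Sections) : (∀ x, map f p x (s x) = t (Loc.emb f x)) →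
    ∀ x, map f q x ((theory M).witness.W p q s x) = (theory N).witness.W p q t (Loc.emb f x)

end FreeBV

/-! ### The complex of linear observables and its `(-1)`-shifted Poisson structure -/

namespace DiffOpComplex
variable {m : ℕ} {M : LorentzManifold.{u} m} (C : DiffOpComplex.{u, v} M)

/-- The differential `Q` on compactly supported sections. -/
noncomputable def Qc (p q : ℤ) : (C.F p).compactSections →ₗ[ℝ] (C.F q).compactSections :=
  (C.Q p q).restrict (SmoothVectorBundle.mapsTo_compactSections (C.Q_diffOp p q))

/-- Degree `n` of the complexification of `𝔉_c(M)[1]`. -/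
abbrev LinObs (n : ℤ) : Type (max u v) := ℂ ⊗[ℝ] (C.F (n + 1)).compactSections

/-- The differential `Q_{[1]} = -Q` of the complexification of `𝔉_c(M)[1]`. -/
noncomputable def linQ (n : ℤ) : C.LinObs n →ₗ[ℂ] C.LinObs (n + 1) :=
  (-C.Qc (n + 1) (n + 1 + 1)).baseChange ℂ

end DiffOpComplex

namespace ShiftedFiberMetric
variable {m : ℕ} {M : LorentzManifold.{u} m} {C : DiffOpComplex.{u, v} M}
  (b : ShiftedFiberMetric C)

theorem hasCompactSupport_pair (p q : ℤ) (s : (C.F p).compactSections) (t : (C.F q).Sections) :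
    HasCompactSupport (fun x ↦ b.pair p q x (s.1 x) (t x)) := by
  refine IsCompact.of_isClosed_subset (s := (C.F p).supp s.1) s.2 isClosed_closure ?_
  refine closure_mono fun x hx h0 ↦ hx ?_
  simp [h0]

/-- The integration pairing `∫_M (ψ₁, ψ₂) vol_M` of compactly supported sections. -/
noncomputable def intPairing (p q : ℤ) :
    (C.F p).compactSections →ₗ[ℝ] (C.F q).compactSections →ₗ[ℝ] ℝ :=
  LinearMap.mk₂ ℝ (fun s t ↦ M.integral fun x ↦ b.pair p q x (s.1 x) (t.1 x))
    (fun s s' t ↦ by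
      rw [← M.integral_add (b.smooth p q s.1 t.1).continuous (b.hasCompactSupport_pair p q s t.1)
        (b.smooth p q s'.1 t.1).continuous (b.hasCompactSupport_pair p q s' t.1)]
      congr 1; ext x
      exact LinearMap.map_add₂ (b.pair p q x) (s.1 x) (s'.1 x) (t.1 x))
    (fun c s t ↦ by
      rw [smul_eq_mul, ← M.integral_smul]
      congr 1; ext x
      exact LinearMap.map_smul₂ (b.pair p q x) c (s.1 x) (t.1 x))
    (fun s t t' ↦ by
      rw [← M.integral_add (b.smooth p q s.1 t.1).continuous (b.hasCompactSupport_pair p q s t.1)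
        (b.smooth p q s.1 t'.1).continuous (b.hasCompactSupport_pair p q s t'.1)]
      congr 1; ext x
      exact map_add (b.pair p q x (s.1 x)) (t.1 x) (t'.1 x))
    (fun c s t ↦ by
      rw [smul_eq_mul, ← M.integral_smul]
      congr 1; ext x
      exact map_smul (b.pair p q x (s.1 x)) c (t.1 x))

/-- The `(-1)`-shifted Poisson structure
`τ₍₋₁₎(ψ₁ ⊗ ψ₂) = (-1)^|ψ₁| ∫_M (ψ₁, ψ₂) vol_M` on `𝔉_c(M)[1]`, where `|ψ₁|` is the degree in
`𝔉_c(M)[1]`. -/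
noncomputable def tauReal (p q : ℤ) :
    (C.F (p + 1)).compactSections →ₗ[ℝ] (C.F (q + 1)).compactSections →ₗ[ℝ] ℝ :=
  (-1 : ℝ) ^ p • b.intPairing (p + 1) (q + 1)

/-- The complex bilinear extension of `τ₍₋₁₎` to the complexification of `𝔉_c(M)[1]`. -/
noncomputable def tau (p q : ℤ) : C.LinObs p →ₗ[ℂ] C.LinObs q →ₗ[ℂ] ℂ :=
  LinearMap.liftBaseChange ℂ
    (((LinearMap.liftBaseChangeEquiv ℂ).restrictScalars ℝ).toLinearMap ∘ₗ
      (LinearMap.llcomp ℝ (C.F (q + 1)).compactSections ℝ ℂ (Algebra.linearMap ℝ ℂ)) ∘ₗ b.tauReal p q)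

theorem tau_tmul (p q : ℤ) (z w : ℂ) (s : (C.F (p + 1)).compactSections)
    (t : (C.F (q + 1)).compactSections) :
    b.tau p q (z ⊗ₜ s) (w ⊗ₜ t) = z * w * (b.tauReal p q s t : ℝ) := by
  simp [tau, mul_assoc]

end ShiftedFiberMetric

/-! ### Pushforward of compactly supported sections -/

namespace NaturalFreeBVTheory
variable {m : ℕ} (T : NaturalFreeBVTheory.{u, v} m) {M N : Loc.{u} m} (f : M ⟶ N)

open scoped Classical in
/-- Extension by zero `f_* s` of a section `s` of `F_M` along `f : M ⟶ N`. -/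
noncomputable def pushFun (n : ℤ) (s : ((T.theory M).F n).Sections) (y : N.toLorentzManifold) :
    ((T.theory N).F n).Fiber y :=
  if h : ∃ x, Loc.emb f x = y then h.choose_spec ▸ T.map f n h.choose (s h.choose) else 0

theorem pushFun_image (n : ℤ) (s : ((T.theory M).F n).Sections) (x : M.toLorentzManifold) :
    T.pushFun f n s (Loc.emb f x) = T.map f n x (s x) := by
  have h : ∃ x', Loc.emb f x' = Loc.emb f x := ⟨x, rfl⟩
  have key : ∀ (x' : M.toLorentzManifold) (e : Loc.emb f x' = Loc.emb f x),
      (e ▸ T.map f n x' (s x') : ((T.theory N).F n).Fiber (Loc.emb f x)) =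
        T.map f n x (s x) := by
    intro x' e
    obtain rfl : x' = x := (Loc.emb f).injective e
    rfl
  rw [pushFun, dif_pos h]
  exact key _ _

theorem pushFun_of_notMem (n : ℤ) (s : ((T.theory M).F n).Sections) (y : N.toLorentzManifold)
    (h : ∀ x, Loc.emb f x ≠ y) : T.pushFun f n s y = 0 := by
  rw [pushFun, dif_neg]
  rintro ⟨x, hx⟩
  exact h x hx

theorem pushFun_support (n : ℤ) (s : ((T.theory M).F n).Sections)
    (y : N.toLorentzManifold) (h : T.pushFun f n s y ≠ 0) :
    y ∈ Loc.emb f '' ((T.theory M).F n).supp s := by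
  by_cases hy : ∃ x, Loc.emb f x = y
  · obtain ⟨x, rfl⟩ := hy
    refine ⟨x, subset_closure fun h0 ↦ h ?_, rfl⟩
    rw [pushFun_image, h0, map_zero]
  · exact absurd (T.pushFun_of_notMem f n s y fun x hx ↦ hy ⟨x, hx⟩) h

theorem isCompact_image_supp (n : ℤ) (s : ((T.theory M).F n).compactSections) :
    IsCompact (Loc.emb f '' ((T.theory M).F n).supp s.1) :=
  IsCompact.image s.2 (Loc.emb f).localDiffeo.contMDiff.continuous

theorem pushFun_smooth (n : ℤ) (s : ((T.theory M).F n).compactSections) :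
    ContMDiff (𝓡 m) ((𝓡 m).prod 𝓘(ℝ, MSpace ((T.theory N).F n).rank)) ∞
      (fun y ↦ Bundle.TotalSpace.mk' (MSpace ((T.theory N).F n).rank)
        (E := ((T.theory N).F n).Fiber) y (T.pushFun f n s.1 y)) := by
  intro y
  by_cases hy : ∃ x, Loc.emb f x = y
  · obtain ⟨x, rfl⟩ := hy
    have hd := (Loc.emb f).localDiffeo x
    have h1 : ContMDiffAt (𝓡 m) (𝓡 m) ∞ hd.localInverse (Loc.emb f x) :=
      hd.localInverse_contMDiffAt
    have h2 := ((T.map_smooth f n).comp s.1.contMDiff).contMDiffAt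
      (x := hd.localInverse (Loc.emb f x))
    refine (h2.comp (Loc.emb f x) h1).congr_of_eventuallyEq ?_
    filter_upwards [hd.localInverse_eventuallyEq_right] with z hz
    have hz' : Loc.emb f (hd.localInverse z) = z := hz
    have h3 : ∀ z' : N.toLorentzManifold, Loc.emb f (hd.localInverse z) = z' →
        Bundle.TotalSpace.mk' (MSpace ((T.theory N).F n).rank)
          (E := ((T.theory N).F n).Fiber) z' (T.pushFun f n s.1 z') =
        ⟨Loc.emb f (hd.localInverse z), T.map f n _ (s.1 (hd.localInverse z))⟩ := by
      rintro _ rfl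
      rw [pushFun_image]
    exact h3 z hz'
  · have hK := (T.isCompact_image_supp f n s).isClosed
    have hyK : y ∉ Loc.emb f '' ((T.theory M).F n).supp s.1 := by
      rintro ⟨x, -, hx⟩
      exact hy ⟨x, hx⟩
    have h0 : ContMDiffAt (𝓡 m) ((𝓡 m).prod 𝓘(ℝ, MSpace ((T.theory N).F n).rank)) ∞
        (fun y ↦ Bundle.TotalSpace.mk' (MSpace ((T.theory N).F n).rank)
        (E := ((T.theory N).F n).Fiber) y 0) y :=
      (Bundle.contMDiff_zeroSection ℝ ((T.theory N).F n).Fiber).contMDiffAt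
    refine h0.congr_of_eventuallyEq ?_
    filter_upwards [hK.isOpen_compl.mem_nhds hyK] with z hz
    have : T.pushFun f n s.1 z = 0 := by
      by_contra h
      exact hz (T.pushFun_support f n s.1 z h)
    rw [this]

/-- The pushforward `f_* : Γ_c(F_M) → Γ_c(F_N)` of compactly supported sections. -/
noncomputable def push (n : ℤ) :
    ((T.theory M).F n).compactSections →ₗ[ℝ] ((T.theory N).F n).compactSections where
  toFun s := ⟨⟨T.pushFun f n s.1, T.pushFun_smooth f n s⟩, by
    have hK := T.isCompact_image_supp f n s
    exact hK.of_isClosed_subset isClosed_closure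
      (closure_minimal (fun y hy ↦ T.pushFun_support f n s.1 y hy) hK.isClosed)⟩
  map_add' s t := by
    apply Subtype.ext
    ext y
    change T.pushFun f n (s.1 + t.1) y = T.pushFun f n s.1 y + T.pushFun f n t.1 y
    by_cases hy : ∃ x, Loc.emb f x = y
    · obtain ⟨x, rfl⟩ := hy
      rw [pushFun_image, pushFun_image, pushFun_image, ← map_add]; rfl
    · have h := fun x hx ↦ hy ⟨x, hx⟩
      rw [pushFun_of_notMem _ _ _ _ _ h, pushFun_of_notMem _ _ _ _ _ h,
        pushFun_of_notMem _ _ _ _ _ h, add_zero]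
  map_smul' c s := by
    apply Subtype.ext
    ext y
    change T.pushFun f n (c • s.1) y = c • T.pushFun f n s.1 y
    by_cases hy : ∃ x, Loc.emb f x = y
    · obtain ⟨x, rfl⟩ := hy
      rw [pushFun_image, pushFun_image, ← map_smul]; rfl
    · have h := fun x hx ↦ hy ⟨x, hx⟩
      rw [pushFun_of_notMem _ _ _ _ _ h, pushFun_of_notMem _ _ _ _ _ h, smul_zero]

/-- The pushforward on the complexification of `𝔉_c[1]`. -/
noncomputable def pushLin (n : ℤ) : (T.theory M).LinObs n →ₗ[ℂ] (T.theory N).LinObs n :=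
  (T.push f (n + 1)).baseChange ℂ

end NaturalFreeBVTheory

/-! ### Symmetric algebras of graded vector spaces -/

section SymmetricAlgebra
universe w
variable (K : Type) [Field K] (V : ℤ → Type w) [∀ n, AddCommGroup (V n)] [∀ n, Module K (V n)]

/-- The relations `v w = (-1)^(|v| |w|) w v`, for homogeneous `v`, `w`, in the tensor algebra. -/
inductive GSym.Rel : TensorAlgebra K (⨁ n, V n) → TensorAlgebra K (⨁ n, V n) → Prop
  | comm (p q : ℤ) (v : V p) (w : V q) : GSym.Rel
      (TensorAlgebra.ι K (DirectSum.lof K ℤ V p v) * TensorAlgebra.ι K (DirectSum.lof K ℤ V q w))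
      ((-1 : K) ^ (p * q) • (TensorAlgebra.ι K (DirectSum.lof K ℤ V q w) *
        TensorAlgebra.ι K (DirectSum.lof K ℤ V p v)))

/-- The symmetric algebra `Sym V` of a graded vector space `V = (V^n)_{n ∈ ℤ}` over a field of
characteristic zero. -/
def GSym : Type w := RingQuot (GSym.Rel K V)

namespace GSym

noncomputable instance : Ring (GSym K V) := inferInstanceAs (Ring (RingQuot (GSym.Rel K V)))
noncomputable instance : Algebra K (GSym K V) :=
  inferInstanceAs (Algebra K (RingQuot (GSym.Rel K V)))

variable {V}

/-- The inclusion `V^n → Sym V`. -/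
noncomputable def ι (n : ℤ) : V n →ₗ[K] GSym K V :=
  (RingQuot.mkAlgHom K (GSym.Rel K V)).toLinearMap ∘ₗ TensorAlgebra.ι K ∘ₗ DirectSum.lof K ℤ V n

theorem ι_comm (p q : ℤ) (v : V p) (w : V q) :
    ι K p v * ι K q w = (-1 : K) ^ (p * q) • (ι K q w * ι K p v) := by
  have h := RingQuot.mkAlgHom_rel K (GSym.Rel.comm (K := K) p q v w)
  rw [map_mul, map_smul, map_mul] at h
  exact h

variable {K}

/-- The universal property of the symmetric algebra. -/
noncomputable def lift {A : Type*} [Semiring A] [Algebra K A] (φ : ∀ n, V n →ₗ[K] A)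
    (h : ∀ p q v w, φ p v * φ q w = (-1 : K) ^ (p * q) • (φ q w * φ p v)) : GSym K V →ₐ[K] A :=
  RingQuot.liftAlgHom K ⟨TensorAlgebra.lift K (DirectSum.toModule K ℤ A φ), by
    rintro _ _ ⟨p, q, v, w⟩
    simpa using h p q v w⟩

theorem lift_ι {A : Type*} [Semiring A] [Algebra K A] (φ : ∀ n, V n →ₗ[K] A)
    (h : ∀ p q v w, φ p v * φ q w = (-1 : K) ^ (p * q) • (φ q w * φ p v)) (n : ℤ) (v : V n) :
    lift φ h (ι K n v) = φ n v := by
  have h1 : lift φ h (ι K n v) =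
      TensorAlgebra.lift K (DirectSum.toModule K ℤ A φ)
        (TensorAlgebra.ι K (DirectSum.lof K ℤ V n v)) :=
    RingQuot.liftAlgHom_mkAlgHom_apply K _ _ _
  rw [h1]
  simp

theorem hom_ext {A : Type*} [Semiring A] [Algebra K A] {f g : GSym K V →ₐ[K] A}
    (h : ∀ n v, f (ι K n v) = g (ι K n v)) : f = g := by
  refine RingQuot.ringQuot_ext' K f g
    (TensorAlgebra.hom_ext (DirectSum.linearMap_ext K fun n ↦ ?_))
  ext v
  exact h n v

/-- Induction principle: a property which holds for `1` and is preserved by linear combinations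
and by left multiplication with elements of `V` holds for all elements of `Sym V`. -/
theorem induction {P : GSym K V → Prop} (one : P 1) (add : ∀ a b, P a → P b → P (a + b))
    (smul : ∀ (c : K) a, P a → P (c • a)) (mul : ∀ n (v : V n) a, P a → P (ι K n v * a))
    (a : GSym K V) : P a := by
  let S : Subalgebra K (GSym K V) :=
    { carrier := {a | ∀ b, P b → P (a * b)}
      mul_mem' := fun {a b} ha hb c hc ↦ by rw [mul_assoc]; exact ha _ (hb _ hc)
      add_mem' := fun {a b} ha hb c hc ↦ by rw [add_mul]; exact add _ _ (ha _ hc) (hb _ hc)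
      algebraMap_mem' := fun r c hc ↦ by rw [← Algebra.smul_def]; exact smul _ _ hc }
  let F : GSym K V →ₐ[K] S := lift
    (fun n ↦ (ι K n).codRestrict (Subalgebra.toSubmodule S) fun v b hb ↦ mul n v b hb)
    (fun p q v w ↦ Subtype.ext (ι_comm K p q v w))
  have hF : S.val.comp F = AlgHom.id K _ := hom_ext fun n v ↦ by
    change S.val (F (ι K n v)) = ι K n v
    rw [lift_ι]; rfl
  have ha : a ∈ S := by
    have := congrArg (fun G : GSym K V →ₐ[K] GSym K V ↦ G a) hF
    change ((F a : S) : GSym K V) = a at this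
    rw [← this]
    exact (F a).2
  have := ha 1 one
  rwa [mul_one] at this

theorem linearMap_ext {W : Type*} [AddCommGroup W] [Module K W] {f g : GSym K V →ₗ[K] W}
    (one : f 1 = g 1) (mul : ∀ n (v : V n) a, f a = g a → f (ι K n v * a) = g (ι K n v * a)) :
    f = g := by
  ext a
  induction a using GSym.induction with
  | one => exact one
  | add a b ha hb => rw [map_add, map_add, ha, hb]
  | smul c a ha => rw [map_smul, map_smul, ha]
  | mul n v a ha => exact mul n v a ha

variable (K V) in
/-- The elements of degree `n` of `Sym V`, spanned by the products `v₁ ⋯ v_k` of homogeneous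
elements whose degrees sum up to `n`. -/
noncomputable def deg (n : ℤ) : Submodule K (GSym K V) :=
  Submodule.span K {a | ∃ l : List (Σ p, V p), (l.map Sigma.fst).sum = n ∧
    a = (l.map fun v ↦ ι K v.1 v.2).prod}

theorem prod_mem_deg (l : List (Σ p, V p)) :
    (l.map fun v ↦ ι K v.1 v.2).prod ∈ deg K V (l.map Sigma.fst).sum :=
  Submodule.subset_span ⟨l, rfl, rfl⟩

theorem ι_mem_deg (n : ℤ) (v : V n) : ι K n v ∈ deg K V n :=
  Submodule.subset_span ⟨[⟨n, v⟩], by simp, by simp⟩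

instance : SetLike.GradedMonoid (deg K V) where
  one_mem := Submodule.subset_span ⟨[], by simp, by simp⟩
  mul_mem i j a b ha hb := by
    have h : a * b ∈ deg K V i * deg K V j := Submodule.mul_mem_mul ha hb
    rw [deg, deg, Submodule.span_mul_span] at h
    refine Submodule.span_mono ?_ h
    rintro _ ⟨_, ⟨l, hl, rfl⟩, _, ⟨l', hl', rfl⟩, rfl⟩
    exact ⟨l ++ l', by simp [hl, hl'], by simp⟩

theorem of_deg_eq {i j : ℤ} (h : i = j) (x : deg K V i) (y : deg K V j) (hxy : x.1 = y.1) :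
    DirectSum.of (fun i ↦ deg K V i) i x = DirectSum.of (fun i ↦ deg K V i) j y := by
  subst h
  rw [Subtype.ext hxy]

variable (K V) in
/-- The inclusion of `V^n` into the direct sum of the homogeneous parts of `Sym V`. -/
noncomputable def degι (n : ℤ) : V n →ₗ[K] ⨁ n, deg K V n :=
  DirectSum.lof K ℤ (fun n ↦ deg K V n) n ∘ₗ (ι K n).codRestrict _ (ι_mem_deg n)

theorem degι_apply (n : ℤ) (v : V n) :
    degι K V n v = DirectSum.of (fun n ↦ deg K V n) n ⟨ι K n v, ι_mem_deg n v⟩ := rfl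

variable (K V) in
/-- The decomposition of `Sym V` into homogeneous elements. -/
noncomputable def decomposeHom : GSym K V →ₐ[K] ⨁ n, deg K V n :=
  lift (degι K V) (fun p q v w ↦ by
      rw [degι_apply, degι_apply, DirectSum.of_mul_of, DirectSum.of_mul_of,
        ← DirectSum.lof_eq_of K, ← DirectSum.lof_eq_of K, ← map_smul]
      exact of_deg_eq (add_comm p q) _ _ (ι_comm K p q v w))

theorem decomposeHom_prod (l : List (Σ p, V p)) :
    decomposeHom K V (l.map fun v ↦ ι K v.1 v.2).prod =
      DirectSum.of (fun i ↦ deg K V i) _ ⟨_, prod_mem_deg l⟩ := by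
  induction l with
  | nil =>
    simp only [List.map_nil, List.prod_nil, map_one]
    rfl
  | cons a l ih =>
    simp only [List.map_cons, List.prod_cons, map_mul]
    rw [ih, decomposeHom, lift_ι, degι_apply, DirectSum.of_mul_of]
    exact of_deg_eq (by simp) _ _ (by simp)

noncomputable instance : GradedAlgebra (deg K V) :=
  GradedAlgebra.ofAlgHom (deg K V) (decomposeHom K V)
    (hom_ext fun n v ↦ by
      rw [AlgHom.comp_apply, decomposeHom, lift_ι, degι_apply, DirectSum.coeAlgHom_of,
        AlgHom.id_apply])
    (fun i x ↦ by
      obtain ⟨x, hx⟩ := x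
      induction hx using Submodule.span_induction with
      | mem x hx =>
        obtain ⟨l, rfl, rfl⟩ := hx
        exact decomposeHom_prod l
      | zero => simp only [map_zero]; exact (map_zero _).symm
      | add x y hx hy ihx ihy =>
        simp only [map_add] at *
        rw [ihx, ihy, ← map_add]; rfl
      | smul c x hx ih =>
        simp only [map_smul] at *
        rw [ih, ← DirectSum.lof_eq_of K, ← map_smul]; rfl)

theorem deg_isInternal : DirectSum.IsInternal (deg K V) :=
  DirectSum.Decomposition.isInternal (deg K V)

/-- The algebra map `Sym f : Sym V → Sym W` extending a graded linear map `f : V → W`. -/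
noncomputable def map {W : ℤ → Type*} [∀ n, AddCommGroup (W n)] [∀ n, Module K (W n)]
    (f : ∀ n, V n →ₗ[K] W n) : GSym K V →ₐ[K] GSym K W :=
  lift (fun n ↦ ι K n ∘ₗ f n) (fun p q v w ↦ ι_comm K p q (f p v) (f q w))

theorem map_ι {W : ℤ → Type*} [∀ n, AddCommGroup (W n)] [∀ n, Module K (W n)]
    (f : ∀ n, V n →ₗ[K] W n) (n : ℤ) (v : V n) : map f (ι K n v) = ι K n (f n v) :=
  lift_ι _ _ n v

/-! Operators `D` on `Sym V` with `D 1 = 0` and prescribed `D (v a) - (-1)^(s |v|) v D a`. -/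

/-- Auxiliary operator `(x, y) ↦ (v x, (-1)^(s |v|) v y + T v x)`. -/
noncomputable def extendAux (s : ℤ) (T : ∀ n, V n →ₗ[K] Module.End K (GSym K V)) (n : ℤ) :
    V n →ₗ[K] Module.End K (GSym K V × GSym K V) where
  toFun v := (LinearMap.mulLeft K (ι K n v) ∘ₗ LinearMap.fst K _ _).prod
    ((-1 : K) ^ (s * n) • (LinearMap.mulLeft K (ι K n v) ∘ₗ LinearMap.snd K _ _) +
      T n v ∘ₗ LinearMap.fst K _ _)
  map_add' v w := by
    refine LinearMap.ext fun x ↦ Prod.ext ?_ ?_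
    · simp [add_mul]
    · simp [add_mul, add_add_add_comm]
  map_smul' c v := by
    refine LinearMap.ext fun x ↦ Prod.ext ?_ ?_
    · simp
    · simp [smul_comm c]

theorem extendAux_apply (s : ℤ) (T : ∀ n, V n →ₗ[K] Module.End K (GSym K V)) (n : ℤ) (v : V n)
    (x : GSym K V × GSym K V) : extendAux s T n v x =
      (ι K n v * x.1, (-1 : K) ^ (s * n) • (ι K n v * x.2) + T n v x.1) := rfl

/-- The condition on `T` under which an operator `D` with `D 1 = 0` and
`D (v a) = (-1)^(s |v|) v D a + T v a` exists. -/
def ExtendCond (s : ℤ) (T : ∀ n, V n →ₗ[K] Module.End K (GSym K V)) : Prop :=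
  ∀ p q (v : V p) (w : V q) (x : GSym K V),
    (-1 : K) ^ (s * p) • (ι K p v * T q w x) + T p v (ι K q w * x) =
      (-1 : K) ^ (p * q) • ((-1 : K) ^ (s * q) • (ι K q w * T p v x) + T q w (ι K p v * x))

/-- The operator `D` on `Sym V` with `D 1 = 0` and `D (v a) = (-1)^(s |v|) v D a + T v a`. -/
noncomputable def extend (s : ℤ) (T : ∀ n, V n →ₗ[K] Module.End K (GSym K V))
    (h : ExtendCond s T) : Module.End K (GSym K V) :=
  LinearMap.snd K _ _ ∘ₗ (LinearMap.applyₗ ((1, 0) : GSym K V × GSym K V)) ∘ₗ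
    (lift (extendAux s T) (fun p q v w ↦ by
      refine LinearMap.ext fun x ↦ Prod.ext ?_ ?_
      · simp only [Module.End.mul_apply, LinearMap.smul_apply, extendAux_apply, Prod.smul_fst,
          ← mul_assoc]
        rw [ι_comm, smul_mul_assoc]
      · simp only [Module.End.mul_apply, LinearMap.smul_apply, extendAux_apply, Prod.smul_snd]
        have h1 := h p q v w x.1
        simp only [mul_add, smul_add, mul_smul_comm, ← mul_assoc] at h1 ⊢
        rw [ι_comm, smul_mul_assoc, add_assoc, h1]
        simp only [smul_smul, ← add_assoc]
        congr 3
        ring)).toLinearMap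

theorem extend_one (s : ℤ) (T : ∀ n, V n →ₗ[K] Module.End K (GSym K V)) (h : ExtendCond s T) :
    extend s T h 1 = 0 := by
  simp [extend]

theorem extend_fst (s : ℤ) (T : ∀ n, V n →ₗ[K] Module.End K (GSym K V)) (h) (a : GSym K V)
    (x : GSym K V × GSym K V) : (lift (extendAux s T) h a x).1 = a * x.1 := by
  induction a using GSym.induction generalizing x with
  | one => simp
  | add a b ha hb => simp [ha, hb, add_mul]
  | smul c a ha => simp [ha]
  | mul n v a ha =>
    rw [map_mul, lift_ι, Module.End.mul_apply, extendAux_apply, ha, mul_assoc]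

theorem extend_mul (s : ℤ) (T : ∀ n, V n →ₗ[K] Module.End K (GSym K V)) (h : ExtendCond s T)
    (n : ℤ) (v : V n) (a : GSym K V) :
    extend s T h (ι K n v * a) = (-1 : K) ^ (s * n) • (ι K n v * extend s T h a) + T n v a := by
  simp only [extend, LinearMap.comp_apply, AlgHom.toLinearMap_apply, map_mul, lift_ι]
  simp only [LinearMap.applyₗ_apply_apply, Module.End.mul_apply, LinearMap.snd_apply,
    extendAux_apply]
  rw [extend_fst, mul_one]

/-! ### The Laplacian of a symmetric pairing -/

variable (K V) in
/-- A symmetric pairing `τ ∈ [V ⊗ V, K]^r` of degree `r`. -/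
structure SymmetricPairing (r : ℤ) where
  toFun (p q : ℤ) : V p →ₗ[K] V q →ₗ[K] K
  degree (p q : ℤ) : p + q + r ≠ 0 → toFun p q = 0
  symm (p q : ℤ) (v : V p) (w : V q) : toFun p q v w = (-1 : K) ^ (p * q) * toFun q p w v

variable {r : ℤ} (τ : SymmetricPairing K V r)

theorem neg_one_zpow_eq (n : ℤ) : (-1 : K) ^ n = 1 ∨ (-1 : K) ^ n = -1 := by
  rcases Int.even_or_odd n with h | h
  · exact Or.inl h.neg_one_zpow
  · exact Or.inr h.neg_one_zpow

theorem contract_cond (p : ℤ) (u : V p) :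
    ExtendCond (p + r) (fun n ↦ LinearMap.lsmul K (GSym K V) ∘ₗ τ.toFun p n u) := by
  intro i j v w x
  have e1 : (-1 : K) ^ ((p + r) * i) * τ.toFun p j u w = (-1 : K) ^ (i * j) * τ.toFun p j u w := by
    by_cases h : p + j + r = 0
    · rw [show (p + r) * i = -(i * j) by linear_combination i * h, zpow_neg]
      rcases neg_one_zpow_eq (K := K) (i * j) with h | h <;> simp [h]
    · simp [τ.degree p j h]
  have e2 : (-1 : K) ^ (i * j) * ((-1 : K) ^ ((p + r) * j) * τ.toFun p i u v) =
      τ.toFun p i u v := by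
    by_cases h : p + i + r = 0
    · rw [show (p + r) * j = -(i * j) by linear_combination j * h, zpow_neg]
      rcases neg_one_zpow_eq (K := K) (i * j) with h | h <;> simp [h]
    · simp [τ.degree p i h]
  simp only [LinearMap.comp_apply, LinearMap.lsmul_apply, mul_smul_comm, smul_add, smul_smul]
  rw [e1, e2, add_comm]

/-- The graded derivation `a ↦ μ ⟨u, a⟩_τ` of `Sym V` of degree `|u| + r`, for `u ∈ V^p`, which on
generators is given by `w ↦ τ(u ⊗ w)`. -/
noncomputable def contractAux (p : ℤ) (u : V p) : Module.End K (GSym K V) :=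
  extend (p + r) _ (contract_cond τ p u)

/-- The graded derivations `a ↦ μ ⟨u, a⟩_τ`, linear in `u ∈ V^p`. -/
noncomputable def contract (p : ℤ) : V p →ₗ[K] Module.End K (GSym K V) where
  toFun := contractAux τ p
  map_add' u v := by
    refine linearMap_ext ?_ fun n w a h ↦ ?_
    · simp only [contractAux, LinearMap.add_apply, extend_one, add_zero]
    · simp only [LinearMap.add_apply] at h ⊢
      simp only [contractAux] at h ⊢
      rw [extend_mul, extend_mul, extend_mul, h]
      simp only [LinearMap.comp_apply, LinearMap.lsmul_apply, map_add,
        LinearMap.add_apply, mul_add, smul_add]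
      abel
  map_smul' c u := by
    refine linearMap_ext ?_ fun n w a h ↦ ?_
    · simp only [contractAux, LinearMap.smul_apply, extend_one, smul_zero]
    · simp only [LinearMap.smul_apply, RingHom.id_apply] at h ⊢
      simp only [contractAux] at h ⊢
      rw [extend_mul, extend_mul, h]
      simp only [LinearMap.comp_apply, LinearMap.lsmul_apply, map_smul,
        LinearMap.smul_apply, mul_smul_comm, smul_add, smul_smul, smul_eq_mul]
      congr 2
      ring

theorem contract_one (p : ℤ) (u : V p) : contract τ p u 1 = 0 :=
  extend_one _ _ (contract_cond τ p u)

theorem contract_ι_mul (p q : ℤ) (u : V p) (w : V q) (a : GSym K V) :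
    contract τ p u (ι K q w * a) =
      (-1 : K) ^ ((p + r) * q) • (ι K q w * contract τ p u a) + τ.toFun p q u w • a :=
  extend_mul _ _ (contract_cond τ p u) _ _ _

theorem laplacian_cond : ExtendCond r (contract τ) := by
  intro p q v w x
  rw [contract_ι_mul, contract_ι_mul, τ.symm p q v w]
  simp only [smul_add, smul_smul]
  have e1 : (-1 : K) ^ (p * q) * (-1 : K) ^ ((q + r) * p) = (-1 : K) ^ (r * p) := by
    rw [← zpow_add₀ (by simp), show p * q + (q + r) * p = r * p + 2 * (p * q) by ring,
      zpow_add₀ (by simp), zpow_mul (-1 : K) 2]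
    simp
  have e2 : (-1 : K) ^ (p * q) * (-1 : K) ^ (r * q) = (-1 : K) ^ ((p + r) * q) := by
    rw [← zpow_add₀ (by simp)]
    congr 1; ring
  rw [e1, e2]
  abel

/-- The Laplacian `Δ_τ` on `Sym V` of a symmetric pairing `τ` of degree `r`. It is determined by
`Δ_τ 1 = 0` and `Δ_τ (v a) = (-1)^(r |v|) v Δ_τ a + μ ⟨v, a⟩_τ` for `v ∈ V`, `a ∈ Sym V`. -/
noncomputable def laplacian : Module.End K (GSym K V) := extend r (contract τ) (laplacian_cond τ)

theorem laplacian_one : laplacian τ 1 = 0 := extend_one _ _ _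

theorem laplacian_ι_mul (n : ℤ) (v : V n) (a : GSym K V) :
    laplacian τ (ι K n v * a) =
      (-1 : K) ^ (r * n) • (ι K n v * laplacian τ a) + contract τ n v a := extend_mul _ _ _ _ _ _

theorem laplacian_ι (n : ℤ) (v : V n) : laplacian τ (ι K n v) = 0 := by
  have h := laplacian_ι_mul τ n v 1
  rwa [mul_one, laplacian_one, contract_one, mul_zero, smul_zero, zero_add] at h

theorem laplacian_ι_mul_ι (p q : ℤ) (v : V p) (w : V q) :
    laplacian τ (ι K p v * ι K q w) = algebraMap K _ (τ.toFun p q v w) := by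
  have h := contract_ι_mul τ p q v w 1
  rw [mul_one, contract_one, mul_zero, smul_zero, zero_add] at h
  rw [laplacian_ι_mul, laplacian_ι, mul_zero, smul_zero, zero_add, h, Algebra.algebraMap_eq_smul_one]

/-! ### The differential of the symmetric algebra of a cochain complex -/

theorem differential_cond (d : ∀ n, V n →ₗ[K] V (n + 1)) :
    ExtendCond 1 (fun n ↦ LinearMap.mul K (GSym K V) ∘ₗ ι K (n + 1) ∘ₗ d n) := by
  intro p q v w x
  simp only [LinearMap.comp_apply, LinearMap.mul_apply', smul_add, smul_smul, ← mul_assoc]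
  rw [ι_comm K p (q + 1), ι_comm K (p + 1) q]
  simp only [smul_mul_assoc, smul_smul]
  have e1 : (-1 : K) ^ (1 * p) * (-1 : K) ^ (p * (q + 1)) = (-1 : K) ^ (p * q) := by
    rw [← zpow_add₀ (by simp), show 1 * p + p * (q + 1) = p * q + 2 * p by ring,
      zpow_add₀ (by simp), zpow_mul (-1 : K) 2]
    simp
  have e2 : (-1 : K) ^ (p * q) * (-1 : K) ^ (1 * q) = (-1 : K) ^ ((p + 1) * q) := by
    rw [← zpow_add₀ (by simp)]
    congr 1; ring
  rw [e1, e2, add_comm]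

/-- The extension of a linear map `d : V → V` of degree `1` to a graded derivation of `Sym V`. -/
noncomputable def differential (d : ∀ n, V n →ₗ[K] V (n + 1)) : Module.End K (GSym K V) :=
  extend 1 _ (differential_cond d)

theorem differential_one (d : ∀ n, V n →ₗ[K] V (n + 1)) :
    differential d (1 : GSym K V) = 0 := extend_one _ _ _

theorem differential_ι_mul (d : ∀ n, V n →ₗ[K] V (n + 1)) (n : ℤ) (v : V n) (a : GSym K V) :
    differential d (ι K n v * a) =
      ι K (n + 1) (d n v) * a + (-1 : K) ^ n • (ι K n v * differential d a) := by
  have h := extend_mul 1 _ (differential_cond d) n v a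
  rw [one_mul, add_comm] at h
  exact h

end GSym
end SymmetricAlgebra

/-! ### Cochain complexes -/

/-- An internally `ℤ`-graded complex vector space together with an endomorphism `d`. -/
structure GradedSpace where
  carrier : Type v
  [addCommGroup : AddCommGroup carrier]
  [module : Module ℂ carrier]
  deg : ℤ → Submodule ℂ carrier
  isInternal : DirectSum.IsInternal deg
  d : carrier →ₗ[ℂ] carrier

namespace GradedSpace

instance : CoeSort GradedSpace.{v} (Type v) := ⟨carrier⟩
attribute [instance] addCommGroup module

/-- `(X, d)` is a cochain complex: `d` has degree `1` and squares to zero. -/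
structure IsCochainComplex (X : GradedSpace.{v}) : Prop where
  d_mem (n : ℤ) (x : X) : x ∈ X.deg n → X.d x ∈ X.deg (n + 1)
  d_comp_d : X.d ∘ₗ X.d = 0

/-- The linear map `x ↦ (-1)^|x| x`. -/
noncomputable def parity (X : GradedSpace.{v}) : X →ₗ[ℂ] X :=
  DirectSum.toModule ℂ ℤ X (fun n ↦ (-1 : ℂ) ^ n • (X.deg n).subtype) ∘ₗ
    (LinearEquiv.ofBijective (DirectSum.coeLinearMap X.deg) X.isInternal).symm.toLinearMap

theorem parity_apply (X : GradedSpace.{v}) (n : ℤ) (x : X) (hx : x ∈ X.deg n) :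
    X.parity x = (-1 : ℂ) ^ n • x := by
  have h : (LinearEquiv.ofBijective (DirectSum.coeLinearMap X.deg) X.isInternal).symm x =
      DirectSum.lof ℂ ℤ (fun n ↦ X.deg n) n ⟨x, hx⟩ := by
    rw [LinearEquiv.symm_apply_eq]
    exact (DirectSum.coeLinearMap_lof X.deg n ⟨x, hx⟩).symm
  rw [parity, LinearMap.comp_apply, LinearEquiv.coe_coe, h, DirectSum.toModule_lof]
  rfl

variable {n : ℕ}

/-- The elements of degree `k` of the tensor product `X₁ ⊗ ⋯ ⊗ X_n`. -/
def tensorDeg (X : Fin n → GradedSpace.{v}) (k : ℤ) : Submodule ℂ (⨂[ℂ] i, X i) :=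
  Submodule.span ℂ {z | ∃ (q : Fin n → ℤ) (x : ∀ i, X i), (∀ i, x i ∈ (X i).deg (q i)) ∧
    ∑ i, q i = k ∧ z = PiTensorProduct.tprod ℂ x}

/-- The differential of the tensor product `X₁ ⊗ ⋯ ⊗ X_n`, given by
`d_⊗ (x₁ ⊗ ⋯ ⊗ x_n) = ∑ᵢ (-1)^(|x₁| + ⋯ + |x_(i-1)|) x₁ ⊗ ⋯ ⊗ d xᵢ ⊗ ⋯ ⊗ x_n`. -/
noncomputable def tensorD (X : Fin n → GradedSpace.{v}) :
    (⨂[ℂ] i, X i) →ₗ[ℂ] (⨂[ℂ] i, X i) :=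
  ∑ i, PiTensorProduct.map fun j ↦
    if j < i then (X j).parity else if j = i then (X j).d else LinearMap.id

/-- Cochain maps `X₁ ⊗ ⋯ ⊗ X_n → Y`: linear maps of degree `0` commuting with the
differentials. -/
structure IsCochainMap {X : Fin n → GradedSpace.{v}} {Y : GradedSpace.{v}}
    (φ : (⨂[ℂ] i, X i) →ₗ[ℂ] Y) : Prop where
  map_mem (k : ℤ) (z : ⨂[ℂ] i, X i) : z ∈ tensorDeg X k → φ z ∈ Y.deg k
  comm : Y.d ∘ₗ φ = φ ∘ₗ tensorD X

end GradedSpace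

/-- The Koszul sign of the permutation `x₁ ⊗ ⋯ ⊗ x_n ↦ ± x_{σ(1)} ⊗ ⋯ ⊗ x_{σ(n)}` of homogeneous
elements of degrees `q₁, …, q_n`. -/
def koszulSign {n : ℕ} (σ : Equiv.Perm (Fin n)) (q : Fin n → ℤ) : ℤˣ :=
  ∏ i, ∏ j, if i < j ∧ σ j < σ i then (-1 : ℤˣ) ^ (q (σ i) * q (σ j)) else 1

/-! ### Time-orderable prefactorization algebras -/

section PrefactorizationAlgebras
open CategoryTheory
variable {m : ℕ}

/-- Time-ordered tuples `(f₁ : M₁ ⟶ N, …, f_n : M_n ⟶ N)`: the causal future of the image of `fᵢ`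
does not meet the image of `fⱼ` for `i < j`. -/
def TimeOrdered {n : ℕ} {M : Fin n → Loc.{u} m} {N : Loc.{u} m} (f : ∀ i, M i ⟶ N) : Prop :=
  ∀ i j, i < j → N.causalFuture (Set.range (Loc.emb (f i))) ∩ Set.range (Loc.emb (f j)) = ∅

/-- Time-orderable tuples: those which admit a time-ordering permutation `ρ`. -/
def TimeOrderable {n : ℕ} {M : Fin n → Loc.{u} m} {N : Loc.{u} m} (f : ∀ i, M i ⟶ N) : Prop :=
  ∃ ρ : Equiv.Perm (Fin n), TimeOrdered fun i ↦ f (ρ i)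

/-- The data of a time-orderable prefactorization algebra on `Loc_m`. -/
structure PFAData (m : ℕ) where
  obj : Loc.{u} m → GradedSpace.{v}
  prod {n : ℕ} {M : Fin n → Loc.{u} m} {N : Loc.{u} m} (f : ∀ i, M i ⟶ N) :
    TimeOrderable f → ((⨂[ℂ] i, obj (M i)) →ₗ[ℂ] obj N)

/-- The composition `f(g₁, …, g_n) = (f₁ g₁₁, …, f_n g_{n k_n})` of tuples, where
`finSigmaFinEquiv` enumerates the pairs `(i, j)` in lexicographic order. -/
def compTuple {n : ℕ} {M : Fin n → Loc.{u} m} {N : Loc.{u} m} (f : ∀ i, M i ⟶ N) {k : Fin n → ℕ}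
    {L : ∀ i, Fin (k i) → Loc.{u} m} (g : ∀ i j, L i j ⟶ M i) (l : Fin (∑ i, k i)) :
    L (finSigmaFinEquiv.symm l).1 (finSigmaFinEquiv.symm l).2 ⟶ N :=
  g (finSigmaFinEquiv.symm l).1 (finSigmaFinEquiv.symm l).2 ≫ f (finSigmaFinEquiv.symm l).1

/-- The data `𝓕` define a time-orderable prefactorization algebra with values in cochain
complexes over `ℂ`. The axioms are spelled out on pure tensors. -/
structure IsTimeOrderablePFA (𝓕 : PFAData.{u, v} m) : Prop where
  /-- each `𝓕(M)` is a cochain complex -/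
  isCochainComplex (M : Loc.{u} m) : (𝓕.obj M).IsCochainComplex
  /-- each `𝓕(f) : 𝓕(M₁) ⊗ ⋯ ⊗ 𝓕(M_n) → 𝓕(N)` is a cochain map -/
  isCochainMap {n : ℕ} {M : Fin n → Loc.{u} m} {N : Loc.{u} m} (f : ∀ i, M i ⟶ N)
    (hf : TimeOrderable f) : GradedSpace.IsCochainMap (𝓕.prod f hf)
  /-- `𝓕(f) ∘ (𝓕(g₁) ⊗ ⋯ ⊗ 𝓕(g_n)) = 𝓕(f(g₁, …, g_n))` -/
  composition {n : ℕ} {M : Fin n → Loc.{u} m} {N : Loc.{u} m} (f : ∀ i, M i ⟶ N)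
    (hf : TimeOrderable f) {k : Fin n → ℕ} {L : ∀ i, Fin (k i) → Loc.{u} m}
    (g : ∀ i j, L i j ⟶ M i) (hg : ∀ i, TimeOrderable (g i)) :
    ∃ hfg : TimeOrderable (compTuple f g), ∀ x : ∀ i j, 𝓕.obj (L i j),
      𝓕.prod f hf (PiTensorProduct.tprod ℂ fun i ↦
        𝓕.prod (g i) (hg i) (PiTensorProduct.tprod ℂ (x i))) =
      𝓕.prod (compTuple f g) hfg (PiTensorProduct.tprod ℂ fun l ↦
        x (finSigmaFinEquiv.symm l).1 (finSigmaFinEquiv.symm l).2)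
  /-- `𝓕(id_M) = id` -/
  identity (M : Loc.{u} m) : ∃ h : TimeOrderable fun _ : Fin 1 ↦ 𝟙 M,
    ∀ x : 𝓕.obj M, 𝓕.prod _ h (PiTensorProduct.tprod ℂ fun _ ↦ x) = x
  /-- `𝓕(f σ) ∘ γ_σ = 𝓕(f)`, where
  `γ_σ (x₁ ⊗ ⋯ ⊗ x_n) = ± x_{σ(1)} ⊗ ⋯ ⊗ x_{σ(n)}` with the Koszul sign -/
  permutation {n : ℕ} {M : Fin n → Loc.{u} m} {N : Loc.{u} m} (f : ∀ i, M i ⟶ N)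
    (hf : TimeOrderable f) (σ : Equiv.Perm (Fin n)) :
    ∃ hfσ : TimeOrderable fun i ↦ f (σ i), ∀ (q : Fin n → ℤ) (x : ∀ i, 𝓕.obj (M i)),
      (∀ i, x i ∈ (𝓕.obj (M i)).deg (q i)) →
      𝓕.prod (fun i ↦ f (σ i)) hfσ
        (((koszulSign σ q : ℤ) : ℂ) • PiTensorProduct.tprod ℂ fun i ↦ x (σ i)) =
      𝓕.prod f hf (PiTensorProduct.tprod ℂ x)

end PrefactorizationAlgebras

/-! ### BV quantization -/

namespace ShiftedFiberMetric
variable {m : ℕ} {M : LorentzManifold.{u} m} {C : DiffOpComplex.{u, v} M}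
  (b : ShiftedFiberMetric C)

theorem tauReal_degree (p q : ℤ) (h : p + q + 1 ≠ 0) : b.tauReal p q = 0 := by
  refine LinearMap.ext₂ fun s t ↦ ?_
  change (-1 : ℝ) ^ p * M.integral (fun x ↦ b.pair (p + 1) (q + 1) x (s.1 x) (t.1 x)) = 0
  have h0 : (fun x ↦ b.pair (p + 1) (q + 1) x (s.1 x) (t.1 x)) = fun x ↦ (0 : ℝ) * 0 := by
    ext x
    rw [b.degree (p + 1) (q + 1) x (by omega)]
    simp
  rw [h0, M.integral_smul, zero_mul, mul_zero]

theorem tauReal_symm (p q : ℤ) (s : (C.F (p + 1)).compactSections)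
    (t : (C.F (q + 1)).compactSections) :
    b.tauReal p q s t = (-1 : ℝ) ^ (p * q) * b.tauReal q p t s := by
  by_cases h : p + q + 1 = 0
  · change (-1 : ℝ) ^ p * M.integral (fun x ↦ b.pair (p + 1) (q + 1) x (s.1 x) (t.1 x)) =
      (-1 : ℝ) ^ (p * q) *
        ((-1 : ℝ) ^ q * M.integral (fun x ↦ b.pair (q + 1) (p + 1) x (t.1 x) (s.1 x)))
    have h0 : (fun x ↦ b.pair (p + 1) (q + 1) x (s.1 x) (t.1 x)) = fun x ↦
        (-(-1 : ℝ) ^ ((p + 1) * (q + 1))) * b.pair (q + 1) (p + 1) x (t.1 x) (s.1 x) := by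
      ext x
      rw [b.antisymm]
      ring
    have e : (-1 : ℝ) ^ ((p + 1) * (q + 1)) = (-1 : ℝ) ^ (p * q) := by
      rw [show (p + 1) * (q + 1) = p * q by linear_combination h]
    have e' : (-1 : ℝ) ^ p = -(-1 : ℝ) ^ q := by
      obtain rfl : p = -(q + 1) := by omega
      rw [zpow_neg, zpow_add₀ (by simp), zpow_one]
      rcases Int.even_or_odd q with h | h <;> simp [h.neg_one_zpow]
    rw [h0, M.integral_smul, e, e']
    ring
  · rw [b.tauReal_degree p q h, b.tauReal_degree q p (by omega)]
    simp

/-- `τ₍₋₁₎` as a symmetric pairing of degree `1` on the complexification of `𝔉_c(M)[1]`. -/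
noncomputable def tauPairing : GSym.SymmetricPairing ℂ C.LinObs 1 where
  toFun := b.tau
  degree p q h := by
    rw [tau, b.tauReal_degree p q h]
    simp
  symm p q v w := by
    induction v using TensorProduct.induction_on with
    | zero => simp
    | add v v' hv hv' => rw [map_add, LinearMap.add_apply, hv, hv', map_add, mul_add]
    | tmul z s =>
      induction w using TensorProduct.induction_on with
      | zero => simp
      | add w w' hw hw' => rw [map_add, hw, hw', map_add, LinearMap.add_apply, mul_add]
      | tmul z' t =>
        rw [tau_tmul, tau_tmul, tauReal_symm]
        push_cast
        ring

end ShiftedFiberMetric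

namespace NaturalFreeBVTheory
variable {m : ℕ} (T : NaturalFreeBVTheory.{u, v} m)

/-- The symmetric algebra of the complexification of `𝔉_c(M)[1]`. -/
abbrev SymObs (M : Loc.{u} m) : Type (max u v) :=
  GSym ℂ fun n ↦ (T.theory M).toDiffOpComplex.LinObs n

/-- The BV Laplacian `Δ_BV`. -/
noncomputable def bvLaplacian (M : Loc.{u} m) : T.SymObs M →ₗ[ℂ] T.SymObs M :=
  GSym.laplacian (T.theory M).metric.tauPairing

/-- The quantized differential `Q_ħ = 𝒬 + i ħ Δ_BV`. -/
noncomputable def quantumDifferential (ħ : ℝ) (M : Loc.{u} m) : T.SymObs M →ₗ[ℂ] T.SymObs M :=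
  GSym.differential (T.theory M).toDiffOpComplex.linQ + (Complex.I * ħ) • T.bvLaplacian M

/-- The complex `𝓕(M) = (Sym(𝔉_c(M)[1]), Q_ħ)` of quantum observables. -/
noncomputable def quantumObs (ħ : ℝ) (M : Loc.{u} m) : GradedSpace.{max u v} where
  carrier := T.SymObs M
  deg := GSym.deg ℂ _
  isInternal := GSym.deg_isInternal
  d := T.quantumDifferential ħ M

/-- The symmetric algebra extension `f_* : Sym(𝔉_c(M)[1]) → Sym(𝔉_c(N)[1])` of the
pushforward of compactly supported sections. -/
noncomputable def pushSym {M N : Loc.{u} m} (f : M ⟶ N) : T.SymObs M →ₐ[ℂ] T.SymObs N :=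
  GSym.map (T.pushLin f)

/-- The time-ordered product `𝓕(f) = μ⁽ⁿ⁾ ∘ (f₁_* ⊗ ⋯ ⊗ f_n_*)`. -/
noncomputable def timeOrderedProduct {n : ℕ} {M : Fin n → Loc.{u} m} {N : Loc.{u} m}
    (f : ∀ i, M i ⟶ N) : (⨂[ℂ] i, T.SymObs (M i)) →ₗ[ℂ] T.SymObs N :=
  PiTensorProduct.lift (MultilinearMap.mkPiAlgebraFin ℂ n (T.SymObs N)) ∘ₗ
    PiTensorProduct.map fun i ↦ (T.pushSym (f i)).toLinearMap

/-- The data of the time-orderable prefactorization algebra of quantum observables. -/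
noncomputable def quantumPFA (ħ : ℝ) : PFAData.{u, max u v} m where
  obj := T.quantumObs ħ
  prod f _ := T.timeOrderedProduct f

end NaturalFreeBVTheory

/-! The pushforwards `f_*` are algebra maps and `Q_ħ` is natural, so the only obstruction to `μ ∘ ⊗
f_{i*}` being a cochain map is that `Q_ħ` is not a derivation. The part `𝒬` is one. The Laplacian
`Δ` is of second order: its defect on `a * b` is built from contractions of the generators in `a`
with those in `b`, that is, from values `τ(v ⊗ w)`. If `a` and `b` come from disjoint regions of
`N`, these values are integrals of functions that vanish identically, and `Q_ħ` satisfies the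
Leibniz rule on `a * b`. A time-orderable tuple has pairwise disjoint images because `S ⊆ J⁺(S)`.
Hence `Q_ħ` obeys the Leibniz rule on time-ordered products (`quantumDifferential_prod`), which is
the cochain map property.

Naturality of `Q_ħ` has two inputs. The operator `Q` commutes with extension by zero because
differential operators do not enlarge supports (`push_Qc`). The pairing `τ` is preserved because the
integral is invariant under isometric embeddings (`LorentzEmbedding.integral_extend_zero`); this is
the change of variables formula, the Jacobian being absorbed by the density `√|det g|`.

The equation `Q_ħ² = 0` splits into `𝒬² = 0`, `Δ² = 0` and `𝒬Δ + Δ𝒬 = 0`. The second holds because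
contractions commute with each other and with `Δ` in the graded sense. The third holds because `τ`
is a cochain map (`tau_linQ`), which is the compatibility of `Q` with the fiber metric.

The remaining axioms are algebraic or causal. Composition uses functoriality of `f_*` and
associativity, permutations use graded commutativity of `Sym`. A composite tuple is time-orderable
by the lexicographic order of ranks: within one `M_i`, causal convexity of the image confines causal
curves of `N` between its points, so that they lift to `M_i`. -/

/-! ### Derivations of graded symmetric algebras -/

namespace GSym
universe w w'
variable {K : Type} [Field K] {V : ℤ → Type w} [∀ n, AddCommGroup (V n)] [∀ n, Module K (V n)]
  {W : ℤ → Type w'} [∀ n, AddCommGroup (W n)] [∀ n, Module K (W n)]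

/-! #### The parity automorphism -/

variable (K V) in
/-- The algebra automorphism `a ↦ (-1)^|a| a`. -/
noncomputable def parityHom : GSym K V →ₐ[K] GSym K V :=
  map fun n ↦ (-1 : K) ^ n • LinearMap.id

theorem parityHom_ι (n : ℤ) (v : V n) : parityHom K V (ι K n v) = (-1 : K) ^ n • ι K n v := by
  rw [parityHom, map_ι, LinearMap.smul_apply, map_smul, LinearMap.id_apply]

theorem parityHom_of_mem_deg {n : ℤ} {a : GSym K V} (ha : a ∈ deg K V n) :
    parityHom K V a = (-1 : K) ^ n • a := by
  induction ha using Submodule.span_induction with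
  | mem a ha =>
    obtain ⟨l, rfl, rfl⟩ := ha
    induction l with
    | nil => simp
    | cons a l ih =>
      simp only [List.map_cons, List.prod_cons, map_mul, List.sum_cons]
      rw [ih, parityHom_ι, smul_mul_smul_comm, zpow_add₀ (by simp)]
  | zero => simp
  | add x y _ _ hx hy => rw [map_add, hx, hy, smul_add]
  | smul c x _ hx => rw [map_smul, hx, smul_comm]

theorem map_parityHom (f : ∀ n, V n →ₗ[K] W n) (a : GSym K V) :
    map f (parityHom K V a) = parityHom K W (map f a) := by
  have h : (map f).comp (parityHom K V) = (parityHom K W).comp (map f) := hom_ext fun n v ↦ by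
    simp [parityHom_ι, map_ι]
  exact DFunLike.congr_fun h a

/-! #### The differential -/

/-- With the Koszul sign written as the parity automorphism, the Leibniz rule makes sense for
inhomogeneous `a`, and it spreads from generators by induction on the first factor. -/
theorem differential_mul (d : ∀ n, V n →ₗ[K] V (n + 1)) (a b : GSym K V) :
    differential d (a * b) = differential d a * b + parityHom K V a * differential d b := by
  induction a using GSym.induction with
  | one => simp [differential_one]
  | add a a' h h' => simp only [add_mul, map_add, h, h']; abel
  | smul c a h => simp only [smul_mul_assoc, map_smul, h, smul_add]
  | mul n v a h =>
    rw [mul_assoc, differential_ι_mul, differential_ι_mul, h, map_mul, parityHom_ι]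
    simp only [add_mul, mul_add, smul_add, smul_mul_assoc, mul_assoc]
    abel

theorem differential_differential (d : ∀ n, V n →ₗ[K] V (n + 1))
    (hd : ∀ n v, d (n + 1) (d n v) = 0) (a : GSym K V) :
    differential d (differential d a) = 0 := by
  induction a using GSym.induction with
  | one => simp [differential_one]
  | add a b ha hb => simp [ha, hb]
  | smul c a ha => simp [ha]
  | mul n v a ha =>
    rw [differential_ι_mul, map_add, map_smul, differential_ι_mul, differential_ι_mul, ha, hd]
    -- The cross terms `d v * d a` occur with the signs `(-1)^(n+1)` and `(-1)^n` and cancel.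
    by_cases hn : Even n <;>
    simp only [neg_one_zpow_eq_ite, Int.even_add, Int.not_even_one, hn] <;>
    simp

theorem differential_mem_deg (d : ∀ n, V n →ₗ[K] V (n + 1)) {n : ℤ} {a : GSym K V}
    (ha : a ∈ deg K V n) : differential d a ∈ deg K V (n + 1) := by
  induction ha using Submodule.span_induction with
  | mem a ha =>
    obtain ⟨l, rfl, rfl⟩ := ha
    induction l with
    | nil => simp [differential_one]
    | cons a l ih =>
      simp only [List.map_cons, List.prod_cons, List.sum_cons]
      rw [differential_ι_mul]
      refine add_mem ?_ (Submodule.smul_mem _ _ ?_)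
      · rw [add_right_comm]
        exact SetLike.mul_mem_graded (ι_mem_deg _ _) (prod_mem_deg l)
      · rw [add_assoc]
        exact SetLike.mul_mem_graded (ι_mem_deg _ _) ih
  | zero => simp
  | add x y _ _ hx hy => rw [map_add]; exact add_mem hx hy
  | smul c x _ hx => rw [map_smul]; exact Submodule.smul_mem _ _ hx

theorem map_differential (f : ∀ n, V n →ₗ[K] W n) (d : ∀ n, V n →ₗ[K] V (n + 1))
    (d' : ∀ n, W n →ₗ[K] W (n + 1)) (h : ∀ n v, f (n + 1) (d n v) = d' n (f n v))
    (a : GSym K V) : map f (differential d a) = differential d' (map f a) := by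
  induction a using GSym.induction with
  | one => simp [differential_one]
  | add a b ha hb => simp only [map_add, ha, hb]
  | smul c a ha => simp only [map_smul, ha]
  | mul n v a ha =>
    rw [differential_ι_mul, map_mul, map_ι, differential_ι_mul, map_add, map_smul, map_mul,
      map_mul, map_ι, map_ι, ha, h]

/-! #### Contractions and the Laplacian -/

/-- Contraction is a graded derivation. The term in which it acts on the second factor is absent
here, and with it the only Koszul sign. -/
theorem contract_mul_of_eq_zero {r : ℤ} (τ : SymmetricPairing K V r) {p : ℤ} {u : V p}
    (a : GSym K V) {b : GSym K V} (hb : contract τ p u b = 0) :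
    contract τ p u (a * b) = contract τ p u a * b := by
  induction a using GSym.induction with
  | one => simp [contract_one, hb]
  | add a a' h h' => simp only [add_mul, map_add, h, h']
  | smul c a h => simp only [smul_mul_assoc, map_smul, h]
  | mul n v a h =>
    rw [mul_assoc, contract_ι_mul, contract_ι_mul, h]
    simp only [add_mul, smul_mul_assoc, mul_assoc]

theorem contract_mem_deg {r : ℤ} (τ : SymmetricPairing K V r) (p : ℤ) (u : V p) {n : ℤ}
    {a : GSym K V} (ha : a ∈ deg K V n) : contract τ p u a ∈ deg K V (p + n + r) := by
  induction ha using Submodule.span_induction with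
  | mem a ha =>
    obtain ⟨l, rfl, rfl⟩ := ha
    induction l with
    | nil => simp [contract_one]
    | cons a l ih =>
      simp only [List.map_cons, List.prod_cons, List.sum_cons]
      rw [contract_ι_mul]
      refine add_mem (Submodule.smul_mem _ _ ?_) ?_
      · rw [show p + (a.1 + (l.map Sigma.fst).sum) + r = a.1 + (p + (l.map Sigma.fst).sum + r) by
          ring]
        exact SetLike.mul_mem_graded (ι_mem_deg _ _) ih
      -- The scalar `τ(u ⊗ v)` can be non-zero only if the degrees of `u` and `v` add up to `-r`,
      -- and then removing `v` produces exactly the expected degree.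
      · by_cases h : p + a.1 + r = 0
        · rw [show p + (a.1 + (l.map Sigma.fst).sum) + r = (l.map Sigma.fst).sum by
            linear_combination h]
          exact Submodule.smul_mem _ _ (prod_mem_deg l)
        · simp [τ.degree _ _ h]
  | zero => simp
  | add x y _ _ hx hy => rw [map_add]; exact add_mem hx hy
  | smul c x _ hx => rw [map_smul]; exact Submodule.smul_mem _ _ hx

theorem laplacian_mem_deg {r : ℤ} (τ : SymmetricPairing K V r) {n : ℤ} {a : GSym K V}
    (ha : a ∈ deg K V n) : laplacian τ a ∈ deg K V (n + r) := by
  induction ha using Submodule.span_induction with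
  | mem a ha =>
    obtain ⟨l, rfl, rfl⟩ := ha
    induction l with
    | nil => simp [laplacian_one]
    | cons a l ih =>
      simp only [List.map_cons, List.prod_cons, List.sum_cons]
      rw [laplacian_ι_mul]
      refine add_mem (Submodule.smul_mem _ _ ?_) ?_
      · rw [add_assoc]
        exact SetLike.mul_mem_graded (ι_mem_deg _ _) ih
      · exact contract_mem_deg τ _ _ (prod_mem_deg l)
  | zero => simp
  | add x y _ _ hx hy => rw [map_add]; exact add_mem hx hy
  | smul c x _ hx => rw [map_smul]; exact Submodule.smul_mem _ _ hx

theorem map_contract {r : ℤ} (τ : SymmetricPairing K V r) (τ' : SymmetricPairing K W r)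
    (f : ∀ n, V n →ₗ[K] W n)
    (h : ∀ p q v w, τ'.toFun p q (f p v) (f q w) = τ.toFun p q v w) (p : ℤ) (u : V p)
    (a : GSym K V) : map f (contract τ p u a) = contract τ' p (f p u) (map f a) := by
  induction a using GSym.induction with
  | one => simp [contract_one]
  | add a b ha hb => simp only [map_add, ha, hb]
  | smul c a ha => simp only [map_smul, ha]
  | mul n v a ha =>
    rw [contract_ι_mul, map_mul, map_ι, contract_ι_mul, map_add, map_smul, map_smul, map_mul,
      map_ι, ha, h]

theorem map_laplacian {r : ℤ} (τ : SymmetricPairing K V r) (τ' : SymmetricPairing K W r)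
    (f : ∀ n, V n →ₗ[K] W n)
    (h : ∀ p q v w, τ'.toFun p q (f p v) (f q w) = τ.toFun p q v w)
    (a : GSym K V) : map f (laplacian τ a) = laplacian τ' (map f a) := by
  induction a using GSym.induction with
  | one => simp [laplacian_one]
  | add a b ha hb => simp only [map_add, ha, hb]
  | smul c a ha => simp only [map_smul, ha]
  | mul n v a ha =>
    rw [laplacian_ι_mul, map_mul, map_ι, laplacian_ι_mul, map_add, map_smul, map_mul,
      map_ι, ha, map_contract τ τ' f h]

/-- Elements of `Sym V` and `Sym V'` have vanishing contractions in `Sym W` if `V` and `V'` are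
mapped to orthogonal subspaces of `W`. -/
theorem contract_map_eq_zero {r : ℤ} (τ : SymmetricPairing K W r) (f : ∀ n, V n →ₗ[K] W n)
    (p : ℤ) (u : W p) (h : ∀ q v, τ.toFun p q u (f q v) = 0) (a : GSym K V) :
    contract τ p u (map f a) = 0 := by
  induction a using GSym.induction with
  | one => simp [contract_one]
  | add a b ha hb => simp only [map_add, ha, hb, add_zero]
  | smul c a ha => simp only [map_smul, ha, smul_zero]
  | mul n v a ha => rw [map_mul, map_ι, contract_ι_mul, ha, h]; simp

/-- The defect of `Δ` from being a derivation consists of contractions of `b` with the generators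
occurring in the first factor. All of these have the form `f p v`, so `hb` removes the defect. -/
theorem laplacian_map_mul (τ : SymmetricPairing K W 1) (f : ∀ n, V n →ₗ[K] W n) (a : GSym K V)
    (b : GSym K W) (hb : ∀ p v, contract τ p (f p v) b = 0) :
    laplacian τ (map f a * b) =
      laplacian τ (map f a) * b + parityHom K W (map f a) * laplacian τ b := by
  induction a using GSym.induction with
  | one => simp [laplacian_one]
  | add a a' h h' => simp only [add_mul, map_add, h, h']; abel
  | smul c a h => simp only [smul_mul_assoc, map_smul, h, smul_add]
  | mul n v a h =>
    rw [map_mul (map f), map_ι, mul_assoc, laplacian_ι_mul, laplacian_ι_mul, h, map_mul (parityHom K W),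
      parityHom_ι, contract_mul_of_eq_zero τ _ (hb _ _), one_mul]
    simp only [add_mul, mul_add, smul_add, smul_mul_assoc, mul_assoc]
    abel

/-! ### Graded commutators of contractions, Laplacian and differential -/

variable (τ : SymmetricPairing K V 1)

/-- Signs in front of `τ(v ⊗ w)` need to agree only where `τ` can be non-zero, so their parities may
be compared under the degree condition. -/
theorem neg_one_zpow_mul_pairing {p q : ℤ} (v : V p) (w : V q) (a b : ℤ)
    (h : p + q + 1 = 0 → (Even a ↔ Even b)) :
    (-1 : K) ^ a * τ.toFun p q v w = (-1 : K) ^ b * τ.toFun p q v w := by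
  by_cases h0 : p + q + 1 = 0
  · simp only [neg_one_zpow_eq_ite, h h0]
  · simp [τ.degree p q h0]

/-- Contractions by `v` and `w` are derivations of degrees `p + 1` and `q + 1`. Their graded
commutator is a derivation that kills generators, since contracting a generator gives a scalar and
contracting a scalar gives zero. -/
theorem contract_contract (p q : ℤ) (v : V p) (w : V q) (a : GSym K V) :
    contract τ p v (contract τ q w a) =
      (-1 : K) ^ ((p + 1) * (q + 1)) • contract τ q w (contract τ p v a) := by
  induction a using GSym.induction with
  | one => simp [contract_one]
  | add a b ha hb => simp only [map_add, ha, hb, smul_add]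
  | smul c a ha => simp only [map_smul, ha]; rw [smul_comm]
  | mul n x a ha =>
    simp only [contract_ι_mul, map_add, map_smul, ha, smul_add, mul_smul_comm]
    have e1 : (-1 : K) ^ ((q + 1) * n) * τ.toFun p n v x =
        (-1 : K) ^ ((p + 1) * (q + 1)) * τ.toFun p n v x :=
      neg_one_zpow_mul_pairing τ v x _ _ fun h ↦ by
        rw [show n = -(p + 1) by omega, mul_neg, even_neg, mul_comm]
    have e2 : (-1 : K) ^ ((p + 1) * (q + 1)) * ((-1 : K) ^ ((p + 1) * n) * τ.toFun q n w x) =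
        τ.toFun q n w x := by
      rw [← mul_assoc, ← zpow_add₀ (by simp)]
      refine (neg_one_zpow_mul_pairing τ w x _ 0 fun h ↦ ?_).trans (by simp)
      rw [show n = -(q + 1) by omega, mul_neg, add_neg_cancel]
    simp only [smul_smul, e1, e2]
    rw [add_assoc, add_assoc, add_comm (_ • contract τ q w a)]
    congr 2
    ring

/-- The graded commutator of `Δ` (degree `1`) and a contraction (degree `p + 1`) vanishes, the sign
being `(-1)^(p+1)`. Splitting off a generator `x` reduces this to the commutation of the
contractions by `v` and `x`. -/
theorem laplacian_contract (p : ℤ) (v : V p) (a : GSym K V) :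
    laplacian τ (contract τ p v a) = -((-1 : K) ^ p • contract τ p v (laplacian τ a)) := by
  induction a using GSym.induction with
  | one => simp [contract_one, laplacian_one]
  | add a b ha hb => simp only [map_add, ha, hb, smul_add, neg_add]
  | smul c a ha => simp only [map_smul, ha, smul_neg]; rw [smul_comm]
  | mul n x a ha =>
    simp only [contract_ι_mul, laplacian_ι_mul, map_add, map_smul, ha, one_mul]
    rw [contract_contract τ p n v x a]
    -- A non-zero value of `τ` forces `p + n = -1`, which is odd.
    have e : (-1 : K) ^ p * ((-1 : K) ^ n * τ.toFun p n v x) = -τ.toFun p n v x := by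
      rw [← mul_assoc, ← zpow_add₀ (by simp)]
      refine (neg_one_zpow_mul_pairing τ v x _ 1 fun h ↦ ?_).trans (by simp)
      rw [show p + n = -1 by omega]
      simp
    simp only [smul_add, smul_smul, neg_add, mul_neg, mul_smul_comm, e, smul_neg]
    by_cases hp : Even p <;> by_cases hn : Even n <;>
    simp only [neg_one_zpow_eq_ite, Int.even_add, Int.even_mul, Int.not_even_one, hp, hn] <;>
    simp <;> abel

/-- On `v * a` the two surviving terms are `(-1)^n ⟨v, Δ a⟩` and `Δ ⟨v, a⟩`, which cancel by
`laplacian_contract`. -/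
theorem laplacian_laplacian (a : GSym K V) : laplacian τ (laplacian τ a) = 0 := by
  induction a using GSym.induction with
  | one => simp [laplacian_one]
  | add a b ha hb => simp [ha, hb]
  | smul c a ha => simp [ha]
  | mul n v a ha =>
    rw [laplacian_ι_mul, map_add, map_smul, laplacian_ι_mul, ha, laplacian_contract]
    simp

/-- The graded commutator of the derivations `d` and `⟨v, ·⟩` is again a derivation, hence
determined on generators `w`. There it is `(-1)^p τ(v ⊗ d w)`, which `hd` identifies with `-τ(d v ⊗
w)`. -/
theorem differential_contract (d : ∀ n, V n →ₗ[K] V (n + 1))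
    (hd : ∀ p q v w, τ.toFun (p + 1) q (d p v) w + (-1 : K) ^ p * τ.toFun p (q + 1) v (d q w) = 0)
    (p : ℤ) (v : V p) (a : GSym K V) :
    differential d (contract τ p v a) =
      -((-1 : K) ^ p • contract τ p v (differential d a)) - contract τ (p + 1) (d p v) a := by
  induction a using GSym.induction with
  | one => simp [contract_one, differential_one]
  | add a b ha hb => simp only [map_add, ha, hb, smul_add, neg_add]; abel
  | smul c a ha =>
    simp only [map_smul, ha, smul_neg, smul_sub]; rw [smul_comm]
  | mul n x a ha =>
    simp only [contract_ι_mul, differential_ι_mul, map_add, map_smul, ha]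
    have e : (-1 : K) ^ p * ((-1 : K) ^ n * τ.toFun p n v x) = -τ.toFun p n v x := by
      rw [← mul_assoc, ← zpow_add₀ (by simp)]
      refine (neg_one_zpow_mul_pairing τ v x _ 1 fun h ↦ ?_).trans (by simp)
      rw [show p + n = -1 by omega]
      simp
    have e' : τ.toFun (p + 1) n (d p v) x = -((-1 : K) ^ p * τ.toFun p (n + 1) v (d n x)) :=
      eq_neg_of_add_eq_zero_left (hd p n v x)
    simp only [smul_add, smul_smul, neg_add, mul_neg, mul_smul_comm, e, e', smul_neg, mul_sub,
      smul_sub]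
    by_cases hp : Even p <;> by_cases hn : Even n <;>
    simp only [neg_one_zpow_eq_ite, Int.even_add, Int.even_mul, Int.not_even_one, hp, hn] <;>
    simp <;> abel

/-- On `v * a` the commutator of `d` with the contraction by `v` contributes `-⟨d v, a⟩`. This is
compensated by the contraction that `Δ` produces from `d v * a`. -/
theorem differential_laplacian (d : ∀ n, V n →ₗ[K] V (n + 1))
    (hd : ∀ p q v w, τ.toFun (p + 1) q (d p v) w + (-1 : K) ^ p * τ.toFun p (q + 1) v (d q w) = 0)
    (a : GSym K V) :
    differential d (laplacian τ a) + laplacian τ (differential d a) = 0 := by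
  induction a using GSym.induction with
  | one => simp [laplacian_one, differential_one]
  | add a b ha hb =>
    simp only [map_add]
    rw [add_add_add_comm, ha, hb, add_zero]
  | smul c a ha =>
    simp only [map_smul]
    rw [← smul_add, ha, smul_zero]
  | mul n v a ha =>
    simp only [differential_ι_mul, laplacian_ι_mul, map_add, map_smul,
      differential_contract τ d hd, eq_neg_of_add_eq_zero_left ha, one_mul]
    by_cases hn : Even n <;>
    simp only [neg_one_zpow_eq_ite, Int.even_add, Int.not_even_one, hn] <;>
    simp <;> abel

end GSym

/-! ### Products of graded commuting elements -/

section KoszulSigns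

/-- The Koszul sign of sorting a list of indices of elements of degrees `q`. -/
def inversionSign {n : ℕ} (q : Fin n → ℤ) : List (Fin n) → ℤˣ
  | [] => 1
  | a :: l => (l.map fun b ↦ if b < a then (-1 : ℤˣ) ^ (q a * q b) else 1).prod *
      inversionSign q l

/-- Connects the recursive sign with the product defining `koszulSign`. The map `f` is not required
to be a permutation, so the induction can drop its first value. -/
theorem inversionSign_ofFn {n k : ℕ} (q : Fin n → ℤ) (f : Fin k → Fin n) :
    inversionSign q (List.ofFn f) =
      ∏ i, ∏ j, if i < j ∧ f j < f i then (-1 : ℤˣ) ^ (q (f i) * q (f j)) else 1 := by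
  induction k with
  | zero => simp [inversionSign]
  | succ k ih =>
    rw [List.ofFn_succ, inversionSign, ih, Fin.prod_univ_succ, Fin.prod_univ_succ]
    simp [List.prod_ofFn, Fin.prod_univ_succ, List.map_ofFn, Function.comp_def]

theorem inversionSign_finRange {n : ℕ} (q : Fin n → ℤ) :
    inversionSign q (List.finRange n) = 1 := by
  rw [← List.ofFn_id, inversionSign_ofFn]
  refine Finset.prod_eq_one fun i _ ↦ Finset.prod_eq_one fun j _ ↦ if_neg ?_
  simp only [id, not_and, not_lt]
  exact fun h ↦ h.le

variable {K A : Type*} [Field K] [Ring A] [Algebra K A]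

/-- Sign times product is unchanged by an adjacent transposition: only the swapped pair changes its
inversion status, and its sign is the one by which the two factors commute. Adjacent transpositions
generate all rearrangements. -/
theorem inversionSign_smul_prod {n : ℕ} (q : Fin n → ℤ) (x : Fin n → A)
    (hx : ∀ i j, x i * x j = (-1 : K) ^ (q i * q j) • (x j * x i))
    {l l' : List (Fin n)} (h : l.Perm l') (hl : l.Nodup) :
    ((inversionSign q l : ℤ) : K) • (l.map x).prod =
      ((inversionSign q l' : ℤ) : K) • (l'.map x).prod := by
  induction h with
  | nil => rfl
  | @cons a l l' h ih =>
    -- The inversions of the head with the tail depend only on which entries the tail has, not on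
    -- their order.
    have e : (l.map fun b ↦ if b < a then (-1 : ℤˣ) ^ (q a * q b) else 1).prod =
        (l'.map fun b ↦ if b < a then (-1 : ℤˣ) ^ (q a * q b) else 1).prod :=
      (h.map _).prod_eq
    have h1 := ih (List.nodup_cons.1 hl).2
    simp only [inversionSign, List.map_cons, List.prod_cons, e, Units.val_mul, Int.cast_mul,
      mul_smul]
    rw [← mul_smul_comm, h1, mul_smul_comm]
  | swap a b l =>
    have hab : b ≠ a := fun h ↦ by simp [h] at hl
    have key : ∀ a b : Fin n, a < b →
        ((inversionSign q (b :: a :: l) : ℤ) : K) • ((b :: a :: l).map x).prod =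
        ((inversionSign q (a :: b :: l) : ℤ) : K) • ((a :: b :: l).map x).prod := by
      intro a b hab
      simp only [inversionSign, List.map_cons, List.prod_cons, if_pos hab, if_neg hab.not_gt,
        one_mul, Units.val_mul, Int.cast_mul, ← mul_assoc (x _)]
      rw [hx b a, smul_mul_assoc, smul_smul]
      congr 1
      rcases Int.even_or_odd (q b * q a) with h | h <;> simp [h.neg_one_zpow] <;> ring
    rcases lt_or_gt_of_ne hab with h | h
    · exact (key b a h).symm
    · exact key a b h
  | trans h h' ih ih' => exact (ih hl).trans (ih' (h.nodup_iff.1 hl))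

/-- Sort the list `σ(1), …, σ(n)` into increasing order, which has no inversions. -/
theorem koszulSign_smul_prod {n : ℕ} (q : Fin n → ℤ) (x : Fin n → A)
    (hx : ∀ i j, x i * x j = (-1 : K) ^ (q i * q j) • (x j * x i)) (σ : Equiv.Perm (Fin n)) :
    ((koszulSign σ q : ℤ) : K) • (List.ofFn fun i ↦ x (σ i)).prod = (List.ofFn x).prod := by
  have h := inversionSign_smul_prod (K := K) q x hx (l := List.ofFn σ) (l' := List.finRange n)
    ((List.perm_ext_iff_of_nodup (List.nodup_ofFn.2 σ.injective) (List.nodup_finRange n)).2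
      fun a ↦ by simpa [List.mem_ofFn] using σ.surjective a) (List.nodup_ofFn.2 σ.injective)
  rw [inversionSign_finRange, inversionSign_ofFn, List.map_ofFn] at h
  rw [List.ofFn_eq_map (f := x), ← one_smul K (List.map x _).prod]
  rw [Units.val_one, Int.cast_one] at h
  exact h

end KoszulSigns

/-- The exponent `p * q` is biadditive, so the commutation sign of generators extends to products.
First one generator is moved past `b` (`h1`), then the generators of `a` one at a time. -/
theorem GSym.mul_comm_of_mem_deg {K : Type} [Field K] {V : ℤ → Type*} [∀ n, AddCommGroup (V n)]
    [∀ n, Module K (V n)] {p q : ℤ} {a b : GSym K V} (ha : a ∈ deg K V p) (hb : b ∈ deg K V q) :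
    a * b = (-1 : K) ^ (p * q) • (b * a) := by
  have h1 : ∀ (n : ℤ) (v : V n) {q : ℤ} {b : GSym K V}, b ∈ deg K V q →
      ι K n v * b = (-1 : K) ^ (n * q) • (b * ι K n v) := by
    intro n v q b hb
    induction hb using Submodule.span_induction with
    | mem b hb =>
      obtain ⟨l, rfl, rfl⟩ := hb
      induction l with
      | nil => simp
      | cons b l ih =>
        simp only [List.map_cons, List.prod_cons, List.sum_cons]
        rw [← mul_assoc, ι_comm, smul_mul_assoc, mul_assoc, ih, mul_smul_comm, smul_smul,
          mul_assoc, mul_add, zpow_add₀ (by simp)]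
    | zero => simp
    | add x y _ _ hx hy => rw [mul_add, hx, hy, add_mul, smul_add]
    | smul c x _ hx => rw [mul_smul_comm, hx, smul_mul_assoc, smul_comm]
  induction ha using Submodule.span_induction with
  | mem a ha =>
    obtain ⟨l, rfl, rfl⟩ := ha
    induction l with
    | nil => simp
    | cons a l ih =>
      simp only [List.map_cons, List.prod_cons, List.sum_cons]
      rw [mul_assoc, ih, mul_smul_comm, ← mul_assoc, h1 _ _ hb, smul_mul_assoc, smul_smul,
        mul_assoc, add_mul, zpow_add₀ (by simp), mul_comm ((-1 : K) ^ _)]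
  | zero => simp
  | add x y _ _ hx hy => rw [add_mul, hx, hy, mul_add, smul_add]
  | smul c x _ hx => rw [smul_mul_assoc, hx, mul_smul_comm, smul_comm]

/-! ### Enumeration of pairs in lexicographic order -/

/-- The position of `(i, j)` is `j` plus the total length of the blocks before `i`, and the blocks
before `i'` include the whole block `i`. -/
theorem finSigmaFinEquiv_lt {n : ℕ} {k : Fin n → ℕ} {i i' : Fin n} (h : i < i') (j : Fin (k i))
    (j' : Fin (k i')) : finSigmaFinEquiv ⟨i, j⟩ < finSigmaFinEquiv ⟨i', j'⟩ := by
  -- Extending `k` by zero to all of `ℕ` turns the sums over the varying types `Fin i` into sums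
  -- over initial segments, which can be compared by inclusion.
  let F : ℕ → ℕ := fun a ↦ if h : a < n then k ⟨a, h⟩ else 0
  have hF : ∀ a : Fin n, ∑ b : Fin a, k (Fin.castLE a.2.le b) = ∑ b ∈ Finset.range a, F b := by
    intro a
    rw [← Fin.sum_univ_eq_sum_range F]
    refine Finset.sum_congr rfl fun b _ ↦ ?_
    simp only [F]
    rw [dif_pos (b.2.trans a.2)]
    rfl
  rw [Fin.lt_def, finSigmaFinEquiv_apply, finSigmaFinEquiv_apply]
  simp only [hF]
  have h1 : ∑ b ∈ Finset.range (i + 1), F b ≤ ∑ b ∈ Finset.range i', F b :=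
    Finset.sum_le_sum_of_subset (Finset.range_mono h)
  rw [Finset.sum_range_succ] at h1
  have h2 : F i = k i := by simp [F]
  have := j.2
  omega

/-- Order matters in a general monoid, so the enumeration itself has to be identified. The
lexicographic list `L` of pairs maps to a strictly increasing list containing every index, and there
is only one such list. -/
theorem prod_ofFn_finSigmaFinEquiv {A : Type*} [Monoid A] {n : ℕ} {k : Fin n → ℕ}
    (y : ∀ i, Fin (k i) → A) :
    (List.ofFn fun i ↦ (List.ofFn (y i)).prod).prod =
      (List.ofFn fun l ↦ y (finSigmaFinEquiv.symm l).1 (finSigmaFinEquiv.symm l).2).prod := by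
  let L : List (Σ i, Fin (k i)) :=
    (List.finRange n).flatMap fun i ↦ (List.finRange (k i)).map (Sigma.mk i)
  have hL : L.map finSigmaFinEquiv = List.finRange (∑ i, k i) := by
    have hs : (L.map finSigmaFinEquiv).Pairwise (· < ·) := by
      rw [List.pairwise_map, List.pairwise_flatMap]
      refine ⟨fun i _ ↦ ?_, ?_⟩
      · rw [List.pairwise_map]
        refine (List.pairwise_lt_finRange _).imp fun {a b} h ↦ ?_
        rw [Fin.lt_def, finSigmaFinEquiv_apply, finSigmaFinEquiv_apply]
        exact Nat.add_lt_add_left h _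
      · refine (List.pairwise_lt_finRange _).imp fun {a b} h ↦ ?_
        simp only [List.mem_map]
        rintro _ ⟨j, -, rfl⟩ _ ⟨j', -, rfl⟩
        exact finSigmaFinEquiv_lt h j j'
    refine List.Perm.eq_of_pairwise' (r := (· < ·)) hs (List.pairwise_lt_finRange _) ?_
    refine (List.perm_ext_iff_of_nodup (hs.imp fun h ↦ h.ne) (List.nodup_finRange _)).2 fun a ↦ ?_
    refine iff_of_true (List.mem_map.2 ⟨finSigmaFinEquiv.symm a, ?_, by simp⟩) (List.mem_finRange a)
    exact List.mem_flatMap.2 ⟨_, List.mem_finRange _, List.mem_map.2 ⟨_, List.mem_finRange _, rfl⟩⟩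
  have h1 : (List.ofFn fun l ↦ y (finSigmaFinEquiv.symm l).1 (finSigmaFinEquiv.symm l).2) =
      L.map fun z ↦ y z.1 z.2 := by
    rw [List.ofFn_eq_map, ← hL, List.map_map]
    refine List.map_congr_left fun z _ ↦ ?_
    rw [Function.comp_apply, Equiv.symm_apply_apply]
  rw [h1, List.map_flatMap, List.flatMap_def, List.prod_flatten, List.map_map, List.ofFn_eq_map]
  congr 1
  refine List.map_congr_left fun i _ ↦ ?_
  rw [List.ofFn_eq_map, Function.comp_apply, List.map_map]
  rfl

/-- The Leibniz rule for products of several factors. -/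
theorem prod_ofFn_leibniz {A : Type*} [Ring A] (d : A →+ A) (par : A → A) (hd : d 1 = 0) {n : ℕ}
    (y : Fin n → A) (P : Fin n → A → Prop) (h1 : ∀ i, P i 1)
    (hm : ∀ i j b, i < j → P i b → P i (y j * b))
    (h : ∀ i b, P i b → d (y i * b) = d (y i) * b + par (y i) * d b) :
    d (List.ofFn y).prod = ∑ i, (List.ofFn fun j ↦
      if j < i then par (y j) else if j = i then d (y j) else y j).prod := by
  induction n with
  | zero => simp [hd]
  | succ n ih =>
    -- `P i b` says that `b` is an admissible right partner for `y i`. The factors after the first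
    -- form such a partner of `y 0`; arbitrary lists of them are treated so that induction applies.
    have hP : P 0 (List.ofFn fun i : Fin n ↦ y i.succ).prod := by
      have : ∀ l : List (Fin n), P 0 (l.map fun i ↦ y i.succ).prod := by
        intro l
        induction l with
        | nil => exact h1 0
        | cons a l ih => exact hm _ _ _ (Fin.succ_pos a) ih
      rw [List.ofFn_eq_map]
      exact this _
    rw [List.ofFn_succ, List.prod_cons, h 0 _ hP, Fin.sum_univ_succ,
      ih (fun i ↦ y i.succ) (fun i ↦ P i.succ) (fun i ↦ h1 _)
        (fun i j b hij ↦ hm _ _ b (Fin.succ_lt_succ_iff.2 hij)) (fun i ↦ h _), Finset.mul_sum]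
    simp only [List.ofFn_succ, List.prod_cons]
    simp [Fin.succ_inj, Fin.succ_ne_zero]

/-! ### Invariance of the integral under isometric embeddings -/

/-- The Gram matrix of `a` is `Jᵀ G J`, with `G` the Gram matrix of `c`. Its determinant is `det J ^
2 * det G`, and the square root turns the square into `|det J|`. -/
theorem sqrt_abs_det_gram {V W ι : Type*} [AddCommGroup V] [Module ℝ V] [AddCommGroup W]
    [Module ℝ W] [Fintype ι] [DecidableEq ι] (gV : V → V → ℝ) (gW : W →ₗ[ℝ] W →ₗ[ℝ] ℝ)
    (F : V → W) (hF : ∀ v w, gW (F v) (F w) = gV v w) (a : ι → V) (c : ι → W)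
    (J : Matrix ι ι ℝ) (hJ : ∀ i, F (a i) = ∑ k, J k i • c k) :
    √|(Matrix.of fun i j ↦ gV (a i) (a j)).det| =
      |J.det| * √|(Matrix.of fun i j ↦ gW (c i) (c j)).det| := by
  have h : (Matrix.of fun i j ↦ gV (a i) (a j)) =
      J.transpose * (Matrix.of fun i j ↦ gW (c i) (c j)) * J := by
    ext i j
    rw [Matrix.of_apply, ← hF, hJ, hJ]
    simp only [map_sum, map_smul, LinearMap.sum_apply, LinearMap.smul_apply, Matrix.mul_apply,
      Matrix.transpose_apply, Matrix.of_apply, smul_eq_mul, Finset.sum_mul, Finset.mul_sum]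
    exact Finset.sum_congr rfl fun k _ ↦ Finset.sum_congr rfl fun l _ ↦ by ring
  rw [h, Matrix.det_mul, Matrix.det_mul, Matrix.det_transpose, mul_right_comm, abs_mul,
    Real.sqrt_mul (abs_nonneg _), abs_mul, Real.sqrt_mul_self (abs_nonneg _)]

namespace LorentzEmbedding
variable {m : ℕ} {M N : LorentzManifold.{u} m}

theorem isOpenEmbedding (f : LorentzEmbedding M N) : IsOpenEmbedding f.toFun :=
  f.localDiffeo.isLocalHomeomorph.isOpenEmbedding_of_injective f.injective

theorem continuous (f : LorentzEmbedding M N) : Continuous f.toFun := f.isOpenEmbedding.continuous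

/-- Continuity need only be checked on the support of the extension, which lies in the image of the
compact support of `h`. There `f` is an open embedding and the extension looks like `h`. -/
theorem continuous_extend_zero (f : LorentzEmbedding M N) {h : M → ℝ} (hc : Continuous h)
    (hs : HasCompactSupport h) : Continuous (Function.extend f.toFun h 0) :=
  continuous_of_tsupport fun x hx ↦ by
    obtain ⟨y, -, rfl⟩ := hs.tsupport_extend_zero_subset f.continuous hx
    rw [← f.isOpenEmbedding.continuousAt_iff, Function.extend_comp f.injective]
    exact hc.continuousAt

/-- The coordinate expression of `f` in the charts around `p` and `q`. -/
noncomputable def inCharts (f : LorentzEmbedding M N) (p : M) (q : N) (y : MSpace m) : MSpace m :=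
  chartAt (MSpace m) q (f ((chartAt (MSpace m) p).symm y))

/-- The derivative of `f` at `x` with respect to the coordinate frames around `p` and `q`. -/
noncomputable def jacobian (f : LorentzEmbedding M N) (p : M) (q : N) (x : M) :
    MSpace m →L[ℝ] MSpace m :=
  (trivializationAt (MSpace m) (TangentSpace (𝓡 m)) q).continuousLinearMapAt ℝ (f x) ∘L
    mfderiv (𝓡 m) (𝓡 m) f.toFun x ∘L
      (trivializationAt (MSpace m) (TangentSpace (𝓡 m)) p).symmL ℝ x

/-- The tangent bundle trivializations around `p` and `q` are given by the derivatives of the charts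
and their inverses, so this is the chain rule. -/
theorem hasFDerivAt_inCharts (f : LorentzEmbedding M N) (p : M) (q : N) {x : M}
    (hx : x ∈ (chartAt (MSpace m) p).source) (hfx : f x ∈ (chartAt (MSpace m) q).source) :
    HasFDerivAt (f.inCharts p q) (f.jacobian p q x) (chartAt (MSpace m) p x) := by
  have e : (chartAt (MSpace m) p).symm (chartAt (MSpace m) p x) = x :=
    (chartAt (MSpace m) p).left_inv hx
  have h1 : HasMFDerivAt 𝓘(ℝ, MSpace m) (𝓡 m) (extChartAt (𝓡 m) p).symm
      (chartAt (MSpace m) p x)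
      ((trivializationAt (MSpace m) (TangentSpace (𝓡 m)) p).symmL ℝ x) := by
    rw [TangentBundle.symmL_trivializationAt hx]
    have := (mdifferentiableWithinAt_extChartAt_symm (I := 𝓡 m) (x := p)
      (z := chartAt (MSpace m) p x) (by simp [hx])).hasMFDerivWithinAt
    simpa using this
  have h2 : HasMFDerivAt (𝓡 m) (𝓡 m) f.toFun ((extChartAt (𝓡 m) p).symm
      (chartAt (MSpace m) p x)) (mfderiv (𝓡 m) (𝓡 m) f.toFun x) := by
    have h : (extChartAt (𝓡 m) p).symm (chartAt (MSpace m) p x) = x := by simpa using e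
    rw [h]
    exact (f.mdifferentiableAt x).hasMFDerivAt
  have h3 : HasMFDerivAt (𝓡 m) 𝓘(ℝ, MSpace m) (extChartAt (𝓡 m) q) (f x)
      ((trivializationAt (MSpace m) (TangentSpace (𝓡 m)) q).continuousLinearMapAt ℝ (f x)) := by
    rw [TangentBundle.continuousLinearMapAt_trivializationAt hfx]
    exact (mdifferentiableAt_extChartAt hfx).hasMFDerivAt
  have h4 : HasMFDerivAt (𝓡 m) 𝓘(ℝ, MSpace m) (extChartAt (𝓡 m) q)
      (f.toFun ((extChartAt (𝓡 m) p).symm (chartAt (MSpace m) p x)))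
      ((trivializationAt (MSpace m) (TangentSpace (𝓡 m)) q).continuousLinearMapAt ℝ (f x)) := by
    have h : (extChartAt (𝓡 m) p).symm (chartAt (MSpace m) p x) = x := by simpa using e
    rw [h]
    exact h3
  have h12 := HasMFDerivAt.comp (chartAt (MSpace m) p x) h2 h1
  have h5 := HasMFDerivAt.comp (chartAt (MSpace m) p x) h4 h12
  exact hasMFDerivAt_iff_hasFDerivAt.1 h5

/-- The derivative of `f` maps the coordinate frame around `p` to the Jacobian matrix applied to the
frame around `q`, and it preserves the metric. The two Gram determinants are therefore related as in
`sqrt_abs_det_gram`. -/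
theorem density_eq (f : LorentzEmbedding M N) (p : M) (q : N) {x : M}
    (hx : x ∈ (chartAt (MSpace m) p).source) (hfx : f x ∈ (chartAt (MSpace m) q).source) :
    M.density p x = |(f.jacobian p q x).det| * N.density q (f x) := by
  have hb : x ∈ (trivializationAt (MSpace m) (TangentSpace (𝓡 m)) p).baseSet := by simpa using hx
  have hb' : f x ∈ (trivializationAt (MSpace m) (TangentSpace (𝓡 m)) q).baseSet := by
    simpa using hfx
  have hM : ∀ i, M.coordField p i x =
      (trivializationAt (MSpace m) (TangentSpace (𝓡 m)) p).symmL ℝ x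
        ((EuclideanSpace.basisFun (Fin m) ℝ).toBasis i) := fun i ↦ by
    rw [LorentzManifold.coordField, Bundle.Trivialization.localFrame_apply_of_mem_baseSet _ _ hb,
      Bundle.Trivialization.basisAt, Module.Basis.map_apply]
    exact (Bundle.Trivialization.symmL_apply _ hb _).symm
  have hN : ∀ i, N.coordField q i (f x) =
      (trivializationAt (MSpace m) (TangentSpace (𝓡 m)) q).symmL ℝ (f x)
        ((EuclideanSpace.basisFun (Fin m) ℝ).toBasis i) := fun i ↦ by
    rw [LorentzManifold.coordField, Bundle.Trivialization.localFrame_apply_of_mem_baseSet _ _ hb',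
      Bundle.Trivialization.basisAt, Module.Basis.map_apply]
    exact (Bundle.Trivialization.symmL_apply _ hb' _).symm
  let b := (EuclideanSpace.basisFun (Fin m) ℝ).toBasis
  have := sqrt_abs_det_gram (fun v w ↦ M.g x v w)
    ((ContinuousLinearMap.coeLM ℝ) ∘ₗ (N.g (f x)).toLinearMap)
    (mfderiv (𝓡 m) (𝓡 m) f.toFun x) (fun v w ↦ f.isometric x v w) (fun i ↦ M.coordField p i x)
    (fun i ↦ N.coordField q i (f x)) (LinearMap.toMatrix b b (f.jacobian p q x).toLinearMap) ?_
  · rw [LinearMap.det_toMatrix] at this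
    exact this
  · intro i
    have h1 : ∑ k, LinearMap.toMatrix b b (f.jacobian p q x).toLinearMap k i • b k =
        f.jacobian p q x (b i) := by
      simp only [LinearMap.toMatrix_apply]
      exact b.sum_repr _
    simp only [hN, hM]
    -- Passing through the trivialization around `q` and back exhibits the image vector as a
    -- combination of the coordinate fields there.
    rw [← Bundle.Trivialization.symmL_continuousLinearMapAt (R := ℝ) _ hb'
      (mfderiv (𝓡 m) (𝓡 m) f.toFun x _)]
    refine (congrArg _ h1.symm).trans ?_
    simp only [map_sum, map_smul]
    rfl

/-- Each integrand carries the partition functions of both `p` and `q`, so both integrals live on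
the overlap of the chart around `p` with the preimage of the chart around `q`. There the change of
variables formula applies, with `density_eq` absorbing the Jacobian. -/
theorem chartIntegral_eq (f : LorentzEmbedding M N) (h : M → ℝ) (p : M) (q : N) :
    M.chartIntegral (fun x ↦ N.partition q (f x) * h x) p =
      N.chartIntegral (Function.extend f.toFun (fun x ↦ M.partition p x * h x) 0) q := by
  set φ := chartAt (MSpace m) p with hφ
  set ψ := chartAt (MSpace m) q with hψ
  set U : Set (MSpace m) := φ.target ∩ φ.symm ⁻¹' (f.toFun ⁻¹' ψ.source) with hU
  have hUo : IsOpen U :=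
    φ.continuousOn_symm.isOpen_inter_preimage φ.open_target
      (ψ.open_source.preimage f.continuous)
  have hθ : ∀ y ∈ U, ψ.symm (f.inCharts p q y) = f (φ.symm y) := fun y hy ↦ ψ.left_inv hy.2
  have hinj : Set.InjOn (f.inCharts p q) U := by
    intro y hy y' hy' h
    have h1 := congrArg ψ.symm h
    rw [hθ y hy, hθ y' hy'] at h1
    exact φ.symm.injOn hy.1 hy'.1 (f.injective h1)
  have hder : ∀ y ∈ U, HasFDerivWithinAt (f.inCharts p q) (f.jacobian p q (φ.symm y)) U y := by
    intro y hy
    have h1 := f.hasFDerivAt_inCharts p q (x := φ.symm y) (φ.map_target hy.1) hy.2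
    rw [← hφ, φ.right_inv hy.1] at h1
    exact h1.hasFDerivWithinAt
  rw [LorentzManifold.chartIntegral, LorentzManifold.chartIntegral, ← hφ, ← hψ,
    MeasureTheory.setIntegral_eq_of_subset_of_forall_sdiff_eq_zero φ.open_target.measurableSet
      (s := U) Set.inter_subset_left,
    MeasureTheory.setIntegral_eq_of_subset_of_forall_sdiff_eq_zero ψ.open_target.measurableSet
      (s := f.inCharts p q '' U),
    MeasureTheory.integral_image_eq_integral_abs_det_fderiv_smul _ hUo.measurableSet hder hinj]
  · refine MeasureTheory.setIntegral_congr_fun hUo.measurableSet fun y hy ↦ ?_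
    rw [hθ y hy, f.injective.extend_apply,
      f.density_eq p q (x := φ.symm y) (φ.map_target hy.1) hy.2, smul_eq_mul]
    ring
  · rintro _ ⟨y, hy, rfl⟩
    exact ψ.map_source hy.2
  -- If the integrand is non-zero at `z`, then `ψ.symm z = f x` with `x` in the support of the
  -- partition function of `p`, hence in the chart around `p`; thus `z` lies in the image of `U`.
  · intro z hz
    by_contra h0
    have h1 : Function.extend f.toFun (fun x ↦ M.partition p x * h x) 0 (ψ.symm z) ≠ 0 := by
      intro h1
      simp [h1] at h0
    obtain ⟨x, hx⟩ : ∃ x, f.toFun x = ψ.symm z := by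
      by_contra h2
      exact h1 (Function.extend_apply' _ _ _ h2)
    rw [← hx, f.injective.extend_apply] at h1
    have hxs : x ∈ φ.source := M.partition_subordinate p (subset_tsupport _ (left_ne_zero_of_mul h1))
    have hxψ : f.toFun x ∈ ψ.source := hx ▸ ψ.map_target hz.1
    refine hz.2 ⟨φ x, ⟨φ.map_source hxs, ?_⟩, ?_⟩
    · simpa [φ.left_inv hxs] using hxψ
    · change ψ (f.toFun (φ.symm (φ x))) = z
      rw [φ.left_inv hxs, hx, ψ.right_inv hz.1]
  -- Outside `U` the point is mapped out of the chart around `q`, where the partition function of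
  -- `q` vanishes.
  · rintro y ⟨hy, hyU⟩
    have h1 : N.partition q (f.toFun (φ.symm y)) = 0 := by
      by_contra h1
      exact hyU ⟨hy, N.partition_subordinate q (subset_tsupport _ h1)⟩
    rw [h1]
    simp

end LorentzEmbedding

namespace LorentzManifold
variable {m : ℕ} {M : LorentzManifold.{u} m}

theorem integral_eq_sum (h : M → ℝ) (s : Finset M)
    (hs : ∀ p ∉ s, ∀ x, M.partition p x * h x = 0) :
    M.integral h = ∑ p ∈ s, M.chartIntegral h p := by
  refine finsum_eq_sum_of_support_subset _ fun p hp ↦ ?_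
  by_contra hps
  exact hp (by simp [chartIntegral, hs p hps])

theorem integral_finset_sum {ι : Type*} (s : Finset ι) (k : ι → M → ℝ)
    (hc : ∀ i, Continuous (k i)) (hs : ∀ i, HasCompactSupport (k i)) :
    M.integral (fun x ↦ ∑ i ∈ s, k i x) = ∑ i ∈ s, M.integral (k i) := by
  classical
  have hcs : ∀ s : Finset ι, HasCompactSupport fun x ↦ ∑ i ∈ s, k i x := by
    intro s
    induction s using Finset.induction_on with
    | empty => simpa using! HasCompactSupport.zero
    | insert a s ha ih =>
      simp only [Finset.sum_insert ha]
      exact (hs a).add ih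
  induction s using Finset.induction_on with
  | empty => simp [integral, chartIntegral]
  | insert a s ha ih =>
    simp only [Finset.sum_insert ha]
    rw [M.integral_add (hc a) (hs a) (continuous_finsetSum _ fun i _ ↦ hc i) (hcs s), ih]

end LorentzManifold

/-- The integral of the extension by zero along a morphism. -/
theorem LorentzEmbedding.integral_extend_zero {m : ℕ} {M N : LorentzManifold.{u} m}
    (f : LorentzEmbedding M N) {h : M → ℝ} (hc : Continuous h) (hs : HasCompactSupport h) :
    N.integral (Function.extend f.toFun h 0) = M.integral h := by
  have hfM := M.partition.locallyFinite.finite_nonempty_inter_compact hs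
  have hfN := N.partition.locallyFinite.finite_nonempty_inter_compact (hs.image f.continuous)
  -- `A` and `B` index the charts whose partition functions meet the support of `h`, respectively
  -- its image in `N`. Both are finite by compactness and local finiteness.
  set A : Finset M := hfM.toFinset with hA
  set B : Finset N := hfN.toFinset with hB
  have hA0 : ∀ p ∉ A, ∀ x, M.partition p x * h x = 0 := by
    intro p hp x
    by_contra h0
    exact hp (hfM.mem_toFinset.2 ⟨x, left_ne_zero_of_mul h0,
      subset_tsupport _ (right_ne_zero_of_mul h0)⟩)
  have hB0 : ∀ q ∉ B, ∀ x, N.partition q (f x) * h x = 0 := by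
    intro q hq x
    by_contra h0
    exact hq (hfN.mem_toFinset.2 ⟨f x, left_ne_zero_of_mul h0,
      x, subset_tsupport _ (right_ne_zero_of_mul h0), rfl⟩)
  have hA1 : ∀ x, ∑ p ∈ A, M.partition p x * h x = h x := by
    intro x
    by_cases hx : h x = 0
    · simp [hx]
    rw [← Finset.sum_mul, ← finsum_eq_sum_of_support_subset (fun p ↦ M.partition p x),
      M.partition.sum_eq_one (Set.mem_univ x), one_mul]
    intro p hp
    by_contra hpA
    exact mul_ne_zero hp hx (hA0 p hpA x)
  have hB1 : ∀ x, ∑ q ∈ B, N.partition q (f x) * h x = h x := by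
    intro x
    by_cases hx : h x = 0
    · simp [hx]
    rw [← Finset.sum_mul, ← finsum_eq_sum_of_support_subset (fun q ↦ N.partition q (f x)),
      N.partition.sum_eq_one (Set.mem_univ (f x)), one_mul]
    intro q hq
    by_contra hqB
    exact mul_ne_zero hq hx (hB0 q hqB x)
  have hcM : ∀ p, Continuous fun x ↦ M.partition p x * h x := fun p ↦
    (M.partition p).contMDiff.continuous.mul hc
  have hsM : ∀ p, HasCompactSupport fun x ↦ M.partition p x * h x := fun p ↦ hs.mul_left
  -- Here the partition of unity of `N`, pulled back along `f`, is inserted on `M`. In `e2` that of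
  -- `M`, extended by zero, is inserted on `N`. The resulting double sums agree term by term.
  have e1 : M.integral h = ∑ q ∈ B, ∑ p ∈ A,
      M.chartIntegral (fun x ↦ N.partition q (f x) * h x) p := by
    conv_lhs => rw [← funext hB1]
    rw [LorentzManifold.integral_finset_sum]
    · refine Finset.sum_congr rfl fun q _ ↦ LorentzManifold.integral_eq_sum _ _ fun p hp x ↦ ?_
      rw [mul_left_comm, hA0 p hp, mul_zero]
    · exact fun q ↦ ((N.partition q).contMDiff.continuous.comp f.continuous).mul hc
    · exact fun q ↦ hs.mul_left
  have e2 : N.integral (Function.extend f.toFun h 0) = ∑ p ∈ A, ∑ q ∈ B,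
      N.chartIntegral (Function.extend f.toFun (fun x ↦ M.partition p x * h x) 0) q := by
    have h1 : Function.extend f.toFun h 0 = fun y ↦ ∑ p ∈ A,
        Function.extend f.toFun (fun x ↦ M.partition p x * h x) 0 y := by
      ext y
      by_cases hy : ∃ x, f.toFun x = y
      · obtain ⟨x, rfl⟩ := hy
        simp only [f.injective.extend_apply]
        exact (hA1 x).symm
      · simp [Function.extend_apply' _ _ _ hy]
    rw [h1, LorentzManifold.integral_finset_sum]
    · refine Finset.sum_congr rfl fun p _ ↦ LorentzManifold.integral_eq_sum _ _ fun q hq y ↦ ?_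
      by_cases hy : ∃ x, f.toFun x = y
      · obtain ⟨x, rfl⟩ := hy
        rw [f.injective.extend_apply, mul_left_comm, hB0 q hq, mul_zero]
      · simp [Function.extend_apply' _ _ _ hy]
    · exact fun p ↦ f.continuous_extend_zero (hcM p) (hsM p)
    · exact fun p ↦ (hsM p).extend_zero f.continuous
  rw [e1, e2, Finset.sum_comm]
  simp only [f.chartIntegral_eq]

/-! ### Pushforward of linear observables -/

namespace NaturalFreeBVTheory
open CategoryTheory
variable {m : ℕ} (T : NaturalFreeBVTheory.{u, v} m) {L M N : Loc.{u} m}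

theorem push_apply (f : M ⟶ N) (n : ℤ) (s : ((T.theory M).F n).compactSections)
    (y : N.toLorentzManifold) : (T.push f n s).1 y = T.pushFun f n s.1 y := rfl

theorem push_id (n : ℤ) (s : ((T.theory M).F n).compactSections) : T.push (𝟙 M) n s = s := by
  apply Subtype.ext
  ext y
  rw [push_apply]
  exact (T.pushFun_image (𝟙 M) n s.1 y).trans (T.map_id M n y _)

theorem push_comp (f : L ⟶ M) (g : M ⟶ N) (n : ℤ) (s : ((T.theory L).F n).compactSections) :
    T.push (f ≫ g) n s = T.push g n (T.push f n s) := by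
  apply Subtype.ext
  ext y
  rw [push_apply, push_apply]
  by_cases hy : ∃ z, Loc.emb g z = y
  · obtain ⟨z, rfl⟩ := hy
    rw [pushFun_image, push_apply]
    by_cases hz : ∃ x, Loc.emb f x = z
    · obtain ⟨x, rfl⟩ := hz
      rw [pushFun_image, ← map_comp]
      exact T.pushFun_image (f ≫ g) n s.1 x
    · rw [T.pushFun_of_notMem f n s.1 z fun x hx ↦ hz ⟨x, hx⟩, map_zero]
      exact T.pushFun_of_notMem (f ≫ g) n s.1 _ fun x hx ↦ hz ⟨x, (Loc.emb g).injective hx⟩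
  · rw [T.pushFun_of_notMem g n _ y fun x hx ↦ hy ⟨x, hx⟩]
    exact T.pushFun_of_notMem (f ≫ g) n s.1 _ fun x hx ↦ hy ⟨_, hx⟩

/-- On the image of `f` this is naturality of `Q`. Off the image the left side is zero by
construction. The right side is zero because a differential operator does not enlarge supports and
the extended section is supported in the closed set `f(supp s)`. -/
theorem push_Qc (f : M ⟶ N) (p q : ℤ) (s : ((T.theory M).F p).compactSections) :
    T.push f q ((T.theory M).Qc p q s) = (T.theory N).Qc p q (T.push f p s) := by
  apply Subtype.ext
  ext y
  change T.pushFun f q ((T.theory M).Q p q s.1) y = (T.theory N).Q p q (T.push f p s).1 y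
  by_cases hy : ∃ x, Loc.emb f x = y
  · obtain ⟨x, rfl⟩ := hy
    rw [pushFun_image]
    exact T.map_Q f p q s.1 (T.push f p s).1 (fun x ↦ (T.pushFun_image f p s.1 x).symm) x
  · rw [T.pushFun_of_notMem f q _ y fun x hx ↦ hy ⟨x, hx⟩]
    obtain ⟨k, hk⟩ := (T.theory N).Q_diffOp p q
    refine (SmoothVectorBundle.diffOp_apply_eq_zero k _ hk _ y fun hys ↦ ?_).symm
    obtain ⟨x, -, hx⟩ := closure_minimal (fun z hz ↦ T.pushFun_support f p s.1 z hz)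
      (T.isCompact_image_supp f p s).isClosed hys
    exact hy ⟨x, hx⟩

/-- Preservation of the fiber metrics makes the pairing of the pushed sections the extension by zero
of the original pairing, whose integral is invariant. -/
theorem intPairing_push (f : M ⟶ N) (p q : ℤ) (s : ((T.theory M).F p).compactSections)
    (t : ((T.theory M).F q).compactSections) :
    (T.theory N).metric.intPairing p q (T.push f p s) (T.push f q t) =
      (T.theory M).metric.intPairing p q s t := by
  change N.integral (fun y ↦ (T.theory N).metric.pair p q y (T.pushFun f p s.1 y)
    (T.pushFun f q t.1 y)) = M.integral fun x ↦ (T.theory M).metric.pair p q x (s.1 x) (t.1 x)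
  rw [← (Loc.emb f).integral_extend_zero ((T.theory M).metric.smooth p q s.1 t.1).continuous
    ((T.theory M).metric.hasCompactSupport_pair p q s t.1)]
  congr 1
  ext y
  by_cases hy : ∃ x, Loc.emb f x = y
  · obtain ⟨x, rfl⟩ := hy
    rw [(Loc.emb f).injective.extend_apply, pushFun_image, pushFun_image, map_metric]
  · rw [Function.extend_apply' _ _ _ hy, T.pushFun_of_notMem f p _ y fun x hx ↦ hy ⟨x, hx⟩]
    simp

/-- At every point of `N` at least one of the two extended sections vanishes. -/
theorem intPairing_push_eq_zero (f : L ⟶ N) (g : M ⟶ N)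
    (h : Disjoint (Set.range (Loc.emb f)) (Set.range (Loc.emb g))) (p q : ℤ)
    (s : ((T.theory L).F p).compactSections) (t : ((T.theory M).F q).compactSections) :
    (T.theory N).metric.intPairing p q (T.push f p s) (T.push g q t) = 0 := by
  have h0 : ∀ y, (T.theory N).metric.pair p q y (T.pushFun f p s.1 y) (T.pushFun g q t.1 y) =
      0 := by
    intro y
    by_cases hy : ∃ x, Loc.emb f x = y
    · rw [T.pushFun_of_notMem g q t.1 y fun x hx ↦ Set.disjoint_left.1 h hy ⟨x, hx⟩, map_zero]
    · rw [T.pushFun_of_notMem f p s.1 y fun x hx ↦ hy ⟨x, hx⟩]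
      simp
  change N.integral (fun y ↦ (T.theory N).metric.pair p q y (T.pushFun f p s.1 y)
    (T.pushFun g q t.1 y)) = 0
  simp [h0, LorentzManifold.integral, LorentzManifold.chartIntegral]

theorem pushLin_tmul (f : M ⟶ N) (n : ℤ) (z : ℂ) (s : ((T.theory M).F (n + 1)).compactSections) :
    T.pushLin f n (z ⊗ₜ s) = z ⊗ₜ T.push f (n + 1) s := rfl

theorem pushLin_id (n : ℤ) (v : (T.theory M).LinObs n) : T.pushLin (𝟙 M) n v = v := by
  induction v using TensorProduct.induction_on with
  | zero => rw [map_zero]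
  | add v w hv hw => rw [map_add, hv, hw]
  | tmul z s => rw [pushLin_tmul, push_id]

theorem pushLin_comp (f : L ⟶ M) (g : M ⟶ N) (n : ℤ) (v : (T.theory L).LinObs n) :
    T.pushLin (f ≫ g) n v = T.pushLin g n (T.pushLin f n v) := by
  induction v using TensorProduct.induction_on with
  | zero => simp only [map_zero]
  | add v w hv hw => simp only [map_add, hv, hw]
  | tmul z s => rw [pushLin_tmul, pushLin_tmul, pushLin_tmul, push_comp]

theorem pushLin_linQ (f : M ⟶ N) (n : ℤ) (v : (T.theory M).LinObs n) :
    T.pushLin f (n + 1) ((T.theory M).linQ n v) = (T.theory N).linQ n (T.pushLin f n v) := by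
  induction v using TensorProduct.induction_on with
  | zero => simp only [map_zero]
  | add v w hv hw => simp only [map_add, hv, hw]
  | tmul z s =>
    change z ⊗ₜ[ℝ] T.push f (n + 1 + 1) (-(T.theory M).Qc (n + 1) (n + 1 + 1) s) =
      z ⊗ₜ[ℝ] (-(T.theory N).Qc (n + 1) (n + 1 + 1) (T.push f (n + 1) s))
    rw [map_neg, push_Qc]

theorem tau_pushLin (f : M ⟶ N) (p q : ℤ) (v : (T.theory M).LinObs p)
    (w : (T.theory M).LinObs q) :
    (T.theory N).metric.tau p q (T.pushLin f p v) (T.pushLin f q w) =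
      (T.theory M).metric.tau p q v w := by
  induction v using TensorProduct.induction_on with
  | zero => simp only [map_zero, LinearMap.zero_apply]
  | add v w hv hw => simp only [map_add, LinearMap.add_apply, hv, hw]
  | tmul z s =>
    induction w using TensorProduct.induction_on with
    | zero => simp only [map_zero]
    | add v w hv hw => simp only [map_add, hv, hw]
    | tmul z' t =>
      rw [pushLin_tmul, pushLin_tmul, ShiftedFiberMetric.tau_tmul, ShiftedFiberMetric.tau_tmul,
        ShiftedFiberMetric.tauReal, ShiftedFiberMetric.tauReal, LinearMap.smul_apply,
        LinearMap.smul_apply, LinearMap.smul_apply, LinearMap.smul_apply, intPairing_push]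

theorem tau_pushLin_eq_zero (f : L ⟶ N) (g : M ⟶ N)
    (h : Disjoint (Set.range (Loc.emb f)) (Set.range (Loc.emb g))) (p q : ℤ)
    (v : (T.theory L).LinObs p) (w : (T.theory M).LinObs q) :
    (T.theory N).metric.tau p q (T.pushLin f p v) (T.pushLin g q w) = 0 := by
  induction v using TensorProduct.induction_on with
  | zero => simp only [map_zero, LinearMap.zero_apply]
  | add v w hv hw => simp only [map_add, LinearMap.add_apply, hv, hw, add_zero]
  | tmul z s =>
    induction w using TensorProduct.induction_on with
    | zero => simp only [map_zero]
    | add v w hv hw => simp only [map_add, hv, hw, add_zero]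
    | tmul z' t =>
      rw [pushLin_tmul, pushLin_tmul, ShiftedFiberMetric.tau_tmul, ShiftedFiberMetric.tauReal,
        LinearMap.smul_apply, LinearMap.smul_apply, intPairing_push_eq_zero _ _ _ h]
      simp

end NaturalFreeBVTheory

/-! ### The differential and the shifted Poisson structure on linear observables -/

theorem DiffOpComplex.linQ_linQ {m : ℕ} {M : LorentzManifold.{u} m} (C : DiffOpComplex.{u, v} M)
    (n : ℤ) (v : C.LinObs n) : C.linQ (n + 1) (C.linQ n v) = 0 := by
  induction v using TensorProduct.induction_on with
  | zero => simp only [map_zero]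
  | add v w hv hw => simp only [map_add, hv, hw, add_zero]
  | tmul z s =>
    have h : C.Qc (n + 1 + 1) (n + 1 + 1 + 1) (C.Qc (n + 1) (n + 1 + 1) s) = 0 :=
      Subtype.ext (LinearMap.congr_fun (C.Q_comp_Q (n + 1) (n + 1 + 1) (n + 1 + 1 + 1)) s.1)
    change z ⊗ₜ[ℝ] (-C.Qc (n + 1 + 1) (n + 1 + 1 + 1) (-C.Qc (n + 1) (n + 1 + 1) s)) = 0
    rw [map_neg, h, neg_zero, neg_zero, TensorProduct.tmul_zero]

/-- Up to the overall sign `(-1)^p` this is the compatibility of `Q` with the fiber metric. A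
section of degree `p` in `𝔉_c(M)[1]` has degree `p + 1` in `F`, and this shift turns the sign in the
definition of `τ` into the required one. -/
theorem ShiftedFiberMetric.tau_linQ {m : ℕ} {M : LorentzManifold.{u} m}
    {C : DiffOpComplex.{u, v} M} (b : ShiftedFiberMetric C) (p q : ℤ) (v : C.LinObs p)
    (w : C.LinObs q) :
    b.tau (p + 1) q (C.linQ p v) w + (-1 : ℂ) ^ p * b.tau p (q + 1) v (C.linQ q w) = 0 := by
  induction v using TensorProduct.induction_on with
  | zero => simp only [map_zero, LinearMap.zero_apply, mul_zero, add_zero]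
  | add v v' hv hv' =>
    simp only [map_add, LinearMap.add_apply, mul_add]
    rw [add_add_add_comm, hv, hv', add_zero]
  | tmul z s =>
    induction w using TensorProduct.induction_on with
    | zero => simp only [map_zero, mul_zero, add_zero]
    | add w w' hw hw' =>
      simp only [map_add, mul_add]
      rw [add_add_add_comm, hw, hw', add_zero]
    | tmul z' t =>
      change b.tau (p + 1) q (z ⊗ₜ[ℝ] (-C.Qc (p + 1) (p + 1 + 1) s)) (z' ⊗ₜ[ℝ] t) + (-1 : ℂ) ^ p *
        b.tau p (q + 1) (z ⊗ₜ[ℝ] s) (z' ⊗ₜ[ℝ] (-C.Qc (q + 1) (q + 1 + 1) t)) = 0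
      have h : b.intPairing (p + 1 + 1) (q + 1) (C.Qc (p + 1) (p + 1 + 1) s) t + (-1 : ℝ) ^ (p + 1) *
          b.intPairing (p + 1) (q + 1 + 1) s (C.Qc (q + 1) (q + 1 + 1) t) = 0 :=
        b.compatible (p + 1) (q + 1) s.1 t.1 (s.2.inter_right isClosed_closure)
      rw [tau_tmul, tau_tmul, tauReal, tauReal]
      simp only [LinearMap.smul_apply, map_neg, LinearMap.neg_apply, smul_eq_mul]
      rw [eq_neg_of_add_eq_zero_left h]
      push_cast
      rcases Int.even_or_odd p with hp | hp <;>
      simp [zpow_add₀, hp.neg_one_zpow]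

/-! ### Time-orderable tuples -/

section TimeOrderable
open CategoryTheory
variable {m : ℕ} {n : ℕ} {M : Fin n → Loc.{u} m} {N : Loc.{u} m}

theorem LorentzManifold.causalFuture_mono (N : LorentzManifold.{u} m) {S S' : Set N}
    (h : S ⊆ S') : N.causalFuture S ⊆ N.causalFuture S' := by
  rintro y (hy | ⟨I, c, hc, a, ha, b, hb, hab, hca, hcb⟩)
  exacts [Or.inl (h hy), Or.inr ⟨I, c, hc, a, ha, b, hb, hab, h hca, hcb⟩]

/-- Sorting by `r` yields a time-ordering permutation. Ranks in an arbitrary linear order are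
convenient because composites carry a natural lexicographic rank. -/
theorem TimeOrderable.of_rank {f : ∀ i, M i ⟶ N} {α : Type*} [LinearOrder α] (r : Fin n → α)
    (hr : Function.Injective r) (h : ∀ i j, r i < r j →
      N.causalFuture (Set.range (Loc.emb (f i))) ∩ Set.range (Loc.emb (f j)) = ∅) :
    TimeOrderable f := by
  refine ⟨Tuple.sort r, fun i j hij ↦ h _ _ ?_⟩
  exact ((Tuple.monotone_sort r).strictMono_of_injective
    (hr.comp (Tuple.sort r).injective)) hij

theorem TimeOrderable.exists_rank {f : ∀ i, M i ⟶ N} (hf : TimeOrderable f) :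
    ∃ r : Fin n → Fin n, Function.Injective r ∧ ∀ i j, r i < r j →
      N.causalFuture (Set.range (Loc.emb (f i))) ∩ Set.range (Loc.emb (f j)) = ∅ := by
  obtain ⟨ρ, hρ⟩ := hf
  refine ⟨ρ.symm, ρ.symm.injective, fun i j h ↦ ?_⟩
  obtain ⟨i, rfl⟩ := ρ.surjective i
  obtain ⟨j, rfl⟩ := ρ.surjective j
  rw [Equiv.symm_apply_apply, Equiv.symm_apply_apply] at h
  exact hρ i j h

/-- The causal future of a set contains the set. Disjointness is all that the cochain map property
needs from time-orderability. -/
theorem TimeOrderable.disjoint_range {f : ∀ i, M i ⟶ N} (hf : TimeOrderable f) {i j : Fin n}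
    (hij : i ≠ j) : Disjoint (Set.range (Loc.emb (f i))) (Set.range (Loc.emb (f j))) := by
  obtain ⟨r, hr, h⟩ := hf.exists_rank
  have key : ∀ i j, r i < r j →
      Disjoint (Set.range (Loc.emb (f i))) (Set.range (Loc.emb (f j))) := fun i j hij ↦
    (Set.disjoint_iff_inter_eq_empty.2 (h i j hij)).mono_left Set.subset_union_left
  rcases lt_or_gt_of_ne (hr.ne hij) with h | h
  exacts [key i j h, (key j i h).symm]

theorem TimeOrderable.perm {f : ∀ i, M i ⟶ N} (hf : TimeOrderable f)
    (σ : Equiv.Perm (Fin n)) : TimeOrderable fun i ↦ f (σ i) := by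
  obtain ⟨r, hr, h⟩ := hf.exists_rank
  exact TimeOrderable.of_rank (fun i ↦ r (σ i)) (hr.comp σ.injective) fun i j hij ↦ h _ _ hij

theorem TimeOrderable.compTuple {f : ∀ i, M i ⟶ N} (hf : TimeOrderable f) {k : Fin n → ℕ}
    {L : ∀ i, Fin (k i) → Loc.{u} m} {g : ∀ i j, L i j ⟶ M i} (hg : ∀ i, TimeOrderable (g i)) :
    TimeOrderable (compTuple f g) := by
  obtain ⟨ρ, hρi, hρ⟩ := hf.exists_rank
  choose ρ' hρi' hρ' using fun i ↦ (hg i).exists_rank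
  -- Lexicographic rank: first the time of the outer region, then the time inside it. The second
  -- component is taken in `ℕ` because `Fin (k i)` varies with `i`.
  let r : (Σ i, Fin (k i)) → Fin n ×ₗ ℕ := fun z ↦ toLex (ρ z.1, (ρ' z.1 z.2 : ℕ))
  have hr : Function.Injective r := by
    rintro ⟨i, j⟩ ⟨i', j'⟩ h
    have h1 : ρ i = ρ i' := congrArg (fun z ↦ (ofLex z).1) h
    obtain rfl := hρi h1
    have h2 : (ρ' i j : ℕ) = ρ' i j' := congrArg (fun z ↦ (ofLex z).2) h
    rw [hρi' i (Fin.ext h2)]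
  have key : ∀ z z', r z < r z' →
      N.causalFuture (Set.range (Loc.emb (g z.1 z.2 ≫ f z.1))) ∩
        Set.range (Loc.emb (g z'.1 z'.2 ≫ f z'.1)) = ∅ := by
    rintro ⟨i, j⟩ ⟨i', j'⟩ h
    have hsub : ∀ i j, Set.range (Loc.emb (g i j ≫ f i)) ⊆ Set.range (Loc.emb (f i)) := by
      rintro i j _ ⟨x, rfl⟩
      exact ⟨Loc.emb (g i j) x, rfl⟩
    rcases Prod.Lex.toLex_lt_toLex.1 h with h | ⟨h, h'⟩
    · have h1 := hρ _ _ h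
      exact Set.eq_empty_of_subset_empty (h1 ▸ Set.inter_subset_inter
        (N.causalFuture_mono (hsub i j)) (hsub i' j'))
    -- Within one outer region a causal relation in `N` descends to `M i` by causal convexity of the
    -- image, where it is excluded by the time-ordering of `g i`.
    · obtain rfl : i = i' := hρi h
      have h1 := hρ' i j j' h'
      refine Set.eq_empty_of_forall_notMem ?_
      rintro _ ⟨hy, x, rfl⟩
      have h2 : Set.range (Loc.emb (g i j ≫ f i)) =
          (Loc.emb (f i)).toFun '' Set.range (Loc.emb (g i j)) :=
        Set.range_comp (Loc.emb (f i)).toFun (Loc.emb (g i j)).toFun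
      rw [h2] at hy
      have h3 := (Loc.emb (f i)).mem_causalFuture_of_image (y := Loc.emb (g i j') x) hy
      exact (Set.eq_empty_iff_forall_notMem.1 h1) _ ⟨h3, x, rfl⟩
  exact TimeOrderable.of_rank (fun l ↦ r (finSigmaFinEquiv.symm l))
    (hr.comp finSigmaFinEquiv.symm.injective) fun l l' h ↦ key _ _ h

end TimeOrderable

/-! ### The factorization algebra of quantum observables -/

namespace NaturalFreeBVTheory
open CategoryTheory
variable {m : ℕ} (T : NaturalFreeBVTheory.{u, v} m) (ħ : ℝ) {L M N : Loc.{u} m}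

theorem quantumDifferential_apply (a : T.SymObs M) : T.quantumDifferential ħ M a =
    GSym.differential (T.theory M).toDiffOpComplex.linQ a +
      (Complex.I * ħ) • GSym.laplacian (T.theory M).metric.tauPairing a := rfl

theorem quantumDifferential_one : T.quantumDifferential ħ M 1 = 0 := by
  rw [quantumDifferential_apply, GSym.differential_one, GSym.laplacian_one, smul_zero, add_zero]

/-- In the square the pure terms `𝒬²` and `Δ²` vanish, and the mixed terms form a multiple of `𝒬Δ +
Δ𝒬`. -/
theorem quantumDifferential_quantumDifferential (a : T.SymObs M) :
    T.quantumDifferential ħ M (T.quantumDifferential ħ M a) = 0 := by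
  have h := GSym.differential_laplacian (T.theory M).metric.tauPairing
    (T.theory M).toDiffOpComplex.linQ (T.theory M).metric.tau_linQ a
  simp only [quantumDifferential_apply, map_add, map_smul, GSym.laplacian_laplacian,
    GSym.differential_differential _ (T.theory M).toDiffOpComplex.linQ_linQ]
  rw [smul_zero, add_zero, zero_add, ← smul_add, add_comm, h, smul_zero]

theorem quantumDifferential_mem_deg {n : ℤ} {a : T.SymObs M} (ha : a ∈ GSym.deg ℂ _ n) :
    T.quantumDifferential ħ M a ∈ GSym.deg ℂ _ (n + 1) := by
  rw [quantumDifferential_apply]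
  exact add_mem (GSym.differential_mem_deg _ ha)
    (Submodule.smul_mem _ _ (GSym.laplacian_mem_deg _ ha))

theorem isCochainComplex_quantumObs (M : Loc.{u} m) : (T.quantumObs ħ M).IsCochainComplex where
  d_mem _ _ hx := T.quantumDifferential_mem_deg ħ hx
  d_comp_d := LinearMap.ext fun a ↦ T.quantumDifferential_quantumDifferential ħ a

/-- Identifies the Koszul sign operator in `tensorD`, defined through the grading, with an algebra
automorphism, which can then be moved past `f_*`. -/
theorem quantumObs_parity_apply (a : T.SymObs M) :
    (T.quantumObs ħ M).parity a = GSym.parityHom ℂ _ a := by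
  induction a using DirectSum.Decomposition.inductionOn (GSym.deg ℂ _) with
  | zero => rw [map_zero]; exact map_zero _
  | homogeneous a =>
    rw [GSym.parityHom_of_mem_deg a.2]
    exact (T.quantumObs ħ M).parity_apply _ _ a.2
  | add a b ha hb => rw [map_add, ← ha, ← hb]; exact map_add _ _ _

theorem pushSym_id (a : T.SymObs M) : T.pushSym (𝟙 M) a = a := by
  have h : T.pushSym (𝟙 M) = AlgHom.id ℂ _ := GSym.hom_ext fun n v ↦ by
    rw [pushSym, GSym.map_ι, pushLin_id, AlgHom.id_apply]
  rw [h, AlgHom.id_apply]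

theorem pushSym_comp (f : L ⟶ M) (g : M ⟶ N) (a : T.SymObs L) :
    T.pushSym (f ≫ g) a = T.pushSym g (T.pushSym f a) := by
  have h : T.pushSym (f ≫ g) = (T.pushSym g).comp (T.pushSym f) := GSym.hom_ext fun n v ↦ by
    rw [AlgHom.comp_apply, pushSym, pushSym, pushSym, GSym.map_ι, GSym.map_ι, GSym.map_ι,
      pushLin_comp]
  rw [h, AlgHom.comp_apply]

theorem pushSym_mem_deg (f : M ⟶ N) {n : ℤ} {a : T.SymObs M} (ha : a ∈ GSym.deg ℂ _ n) :
    T.pushSym f a ∈ GSym.deg ℂ _ n := by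
  induction ha using Submodule.span_induction with
  | mem a ha =>
    obtain ⟨l, rfl, rfl⟩ := ha
    rw [map_list_prod, List.map_map]
    have h := GSym.prod_mem_deg (K := ℂ) (l.map fun z ↦
      (⟨z.1, T.pushLin f z.1 z.2⟩ : Σ p, (T.theory N).toDiffOpComplex.LinObs p))
    simpa [List.map_map, Function.comp_def, pushSym, GSym.map_ι] using h
  | zero => rw [map_zero]; exact zero_mem _
  | add x y _ _ hx hy => rw [map_add]; exact add_mem hx hy
  | smul c x _ hx => rw [map_smul]; exact Submodule.smul_mem _ _ hx

theorem pushSym_quantumDifferential (f : M ⟶ N) (a : T.SymObs M) :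
    T.pushSym f (T.quantumDifferential ħ M a) = T.quantumDifferential ħ N (T.pushSym f a) := by
  rw [quantumDifferential_apply, quantumDifferential_apply, map_add, map_smul]
  congr 1
  · exact GSym.map_differential _ _ _ (T.pushLin_linQ f) a
  · congr 1
    exact GSym.map_laplacian _ _ _ (T.tau_pushLin f) a

variable {n : ℕ} {K : Fin n → Loc.{u} m}

theorem timeOrderedProduct_tprod (f : ∀ i, K i ⟶ N) (x : ∀ i, T.SymObs (K i)) :
    T.timeOrderedProduct f (PiTensorProduct.tprod ℂ x) =
      (List.ofFn fun i ↦ T.pushSym (f i) (x i)).prod := by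
  rw [timeOrderedProduct, LinearMap.comp_apply, PiTensorProduct.map_tprod,
    PiTensorProduct.lift.tprod]
  rfl

/-- The admissible right factors for the `i`-th region are the `b` annihilated by all contractions
with generators pushed forward along `f i`. They contain `1` and are stable under multiplication by
observables of the other regions, since `τ` vanishes between disjoint regions. For such `b` the
defect of `Δ` from the Leibniz rule is zero. -/
theorem quantumDifferential_prod {f : ∀ i, K i ⟶ N} (hf : TimeOrderable f)
    (x : ∀ i, T.SymObs (K i)) :
    T.quantumDifferential ħ N (List.ofFn fun i ↦ T.pushSym (f i) (x i)).prod =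
      ∑ i, (List.ofFn fun j ↦ if j < i then GSym.parityHom ℂ _ (T.pushSym (f j) (x j))
        else if j = i then T.quantumDifferential ħ N (T.pushSym (f j) (x j))
        else T.pushSym (f j) (x j)).prod := by
  refine prod_ofFn_leibniz (T.quantumDifferential ħ N).toAddMonoidHom (GSym.parityHom ℂ _)
    (T.quantumDifferential_one ħ) (fun i ↦ T.pushSym (f i) (x i))
    (fun i b ↦ ∀ p v, GSym.contract (T.theory N).metric.tauPairing p (T.pushLin (f i) p v) b = 0)
    (fun i p v ↦ GSym.contract_one _ _ _) (fun i j b hij hb p v ↦ ?_) (fun i b hb ↦ ?_)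
  · rw [GSym.contract_mul_of_eq_zero _ _ (hb p v), pushSym, GSym.contract_map_eq_zero, zero_mul]
    exact fun q w ↦ T.tau_pushLin_eq_zero (f i) (f j) (hf.disjoint_range hij.ne) p q v w
  · change T.quantumDifferential ħ N _ = T.quantumDifferential ħ N _ * _ + _ *
      T.quantumDifferential ħ N _
    simp only [quantumDifferential_apply]
    rw [GSym.differential_mul, pushSym, GSym.laplacian_map_mul _ _ _ _ hb]
    simp only [add_mul, mul_add, smul_add, smul_mul_assoc, mul_smul_comm]
    abel

theorem timeOrderedProduct_comm {f : ∀ i, K i ⟶ N} (hf : TimeOrderable f) :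
    T.quantumDifferential ħ N ∘ₗ T.timeOrderedProduct f =
      T.timeOrderedProduct f ∘ₗ GradedSpace.tensorD fun i ↦ T.quantumObs ħ (K i) := by
  refine PiTensorProduct.ext (MultilinearMap.ext fun x ↦ ?_)
  change T.quantumDifferential ħ N (T.timeOrderedProduct f (PiTensorProduct.tprod ℂ x)) =
    T.timeOrderedProduct f (GradedSpace.tensorD (fun i ↦ T.quantumObs ħ (K i))
      (PiTensorProduct.tprod ℂ x))
  rw [timeOrderedProduct_tprod, T.quantumDifferential_prod ħ hf, GradedSpace.tensorD,
    LinearMap.sum_apply]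
  refine Eq.trans ?_ (map_sum _ _ _).symm
  refine Finset.sum_congr rfl fun i _ ↦ ?_
  refine Eq.trans ?_ (congrArg (T.timeOrderedProduct f)
    (PiTensorProduct.map_tprod (s := fun i ↦ T.quantumObs ħ (K i)) _ x).symm)
  refine Eq.trans ?_ (T.timeOrderedProduct_tprod f _).symm
  congr 2
  funext j
  -- Factors before the `i`-th match because parity commutes with `f_*`, the `i`-th because `Q_ħ`
  -- does; the later ones are untouched.
  split_ifs
  · refine (GSym.map_parityHom _ _).symm.trans ?_
    exact congrArg _ (T.quantumObs_parity_apply ħ (x j)).symm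
  · exact (T.pushSym_quantumDifferential ħ (f j) (x j)).symm
  · rfl

theorem timeOrderedProduct_mem_deg (f : ∀ i, K i ⟶ N) {k : ℤ} {z : ⨂[ℂ] i, T.SymObs (K i)}
    (hz : z ∈ GradedSpace.tensorDeg (fun i ↦ T.quantumObs ħ (K i)) k) :
    T.timeOrderedProduct f z ∈ GSym.deg ℂ _ k := by
  induction hz using Submodule.span_induction with
  | mem z hz =>
    obtain ⟨q, x, hx, rfl, rfl⟩ := hz
    have h := SetLike.list_prod_map_mem_graded (A := GSym.deg ℂ _) (List.finRange n) q
      (fun i ↦ T.pushSym (f i) (x i)) fun i _ ↦ T.pushSym_mem_deg (f i) (hx i)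
    rw [← List.ofFn_eq_map, ← List.ofFn_eq_map, List.sum_ofFn] at h
    exact (T.timeOrderedProduct_tprod f x).symm ▸ h
  | zero => rw [map_zero]; exact zero_mem _
  | add x y _ _ hx hy => exact (map_add (T.timeOrderedProduct f) x y).symm ▸ add_mem hx hy
  | smul c x _ hx =>
    exact (map_smul (T.timeOrderedProduct f) c x).symm ▸ Submodule.smul_mem _ _ hx

/-- Each `f_{i*}` is multiplicative and functorial, so both sides multiply the same factors; only
the bracketing differs. -/
theorem timeOrderedProduct_compTuple (f : ∀ i, K i ⟶ N) {k : Fin n → ℕ}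
    {L : ∀ i, Fin (k i) → Loc.{u} m} (g : ∀ i j, L i j ⟶ K i) (x : ∀ i j, T.SymObs (L i j)) :
    T.timeOrderedProduct f (PiTensorProduct.tprod ℂ fun i ↦
        T.timeOrderedProduct (g i) (PiTensorProduct.tprod ℂ (x i))) =
      T.timeOrderedProduct (compTuple f g) (PiTensorProduct.tprod ℂ fun l ↦
        x (finSigmaFinEquiv.symm l).1 (finSigmaFinEquiv.symm l).2) := by
  simp only [timeOrderedProduct_tprod, map_list_prod, List.map_ofFn, Function.comp_def]
  rw [prod_ofFn_finSigmaFinEquiv fun i j ↦ T.pushSym (f i) (T.pushSym (g i j) (x i j))]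
  simp only [compTuple, pushSym_comp]

theorem timeOrderedProduct_perm (f : ∀ i, K i ⟶ N) (σ : Equiv.Perm (Fin n)) (q : Fin n → ℤ)
    (x : ∀ i, T.SymObs (K i)) (hx : ∀ i, x i ∈ GSym.deg ℂ _ (q i)) :
    T.timeOrderedProduct (fun i ↦ f (σ i))
        (((koszulSign σ q : ℤ) : ℂ) • PiTensorProduct.tprod ℂ fun i ↦ x (σ i)) =
      T.timeOrderedProduct f (PiTensorProduct.tprod ℂ x) := by
  rw [map_smul, timeOrderedProduct_tprod, timeOrderedProduct_tprod]
  exact koszulSign_smul_prod q (fun i ↦ T.pushSym (f i) (x i)) (fun i j ↦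
    GSym.mul_comm_of_mem_deg (T.pushSym_mem_deg _ (hx i)) (T.pushSym_mem_deg _ (hx j))) σ

theorem isTimeOrderablePFA_quantumPFA : IsTimeOrderablePFA (T.quantumPFA ħ) where
  isCochainComplex M := T.isCochainComplex_quantumObs ħ M
  isCochainMap f hf :=
    ⟨fun k z hz ↦ T.timeOrderedProduct_mem_deg ħ f hz, T.timeOrderedProduct_comm ħ hf⟩
  composition f hf _ _ g hg :=
    ⟨hf.compTuple hg, fun x ↦ T.timeOrderedProduct_compTuple f g x⟩
  identity M := by
    -- A tuple of length one has no pair `i < j`, so any permutation orders it.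
    refine ⟨⟨1, fun i j h ↦ absurd h (by omega)⟩, fun x ↦ ?_⟩
    refine (T.timeOrderedProduct_tprod (fun _ : Fin 1 ↦ 𝟙 M) fun _ ↦ x).trans ?_
    rw [List.ofFn_succ, List.ofFn_zero, List.prod_singleton]
    exact T.pushSym_id x
  permutation f hf σ := ⟨hf.perm σ, fun q x hx ↦ T.timeOrderedProduct_perm f σ q x hx⟩

end NaturalFreeBVTheory

theorem mainTheorem5 (m : ℕ) (T : NaturalFreeBVTheory.{u, v} m) (ħ : ℝ) (hħ : 0 < ħ) :
    (∀ (n : ℕ) (M : Fin n → Loc.{u} m) (N : Loc.{u} m) (f : ∀ i, M i ⟶ N), TimeOrderable f →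
      (∀ k, ∀ z ∈ GradedSpace.tensorDeg (fun i ↦ T.quantumObs ħ (M i)) k,
        T.timeOrderedProduct f z ∈ (T.quantumObs ħ N).deg k) ∧
      T.quantumDifferential ħ N ∘ₗ T.timeOrderedProduct f =
        T.timeOrderedProduct f ∘ₗ GradedSpace.tensorD fun i ↦ T.quantumObs ħ (M i)) ∧
    IsTimeOrderablePFA (T.quantumPFA ħ) :=
  ⟨fun _ _ _ f hf ↦ ⟨fun _ _ hz ↦ T.timeOrderedProduct_mem_deg ħ f hz,
    T.timeOrderedProduct_comm ħ hf⟩, T.isTimeOrderablePFA_quantumPFA ħ⟩
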